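/- For $f\in\mathcal S'(\mathbb R^n)$ let $\widehat f$ be its Fourier transform, normalized so that $\widehat f(\xi)=(2\pi)^{-n/2}\int_{\mathbb R^n}e^{-ix\cdot\xi}f(x)\,dx$ for integrable $f$, let $f^\vee$ be the inverse transform, and let $e^{it\Delta}f=(e^{-it|\xi|^2}\widehat f\,)^{\vee}$. For exponents $p,q$ and $A_1,A_2>0$ write $f=O_{p,q}(A_1;A_2)$ if $f$ and $\widehat f$ are functions with $e^{A_1|\cdot|^2}f\in L^p(\mathbb R^n)$ and $e^{A_2|\cdot|^2}\widehat f\in L^q(\mathbb R^n)$; the number attached to this relation is $M_{p,q}(f)=A_1A_2$ (it depends on the constants in the relation and not on $f$ alone). Write $O_p$ for $O_{p,p}$. Let $p,q,r\in[1,\infty]$, $1/p+1/r=1/l$ (so $l\in[1/2,\infty]$), $A_1,A_2,B_1,B_2,C_1,C_2>0$, and $f,g,h\in\mathcal S'(\mathbb R^n)$. (a) If $f=O_{p,q}(A_1;A_2)$, then $\widehat f=O_{q,p}(A_2;A_1)$. (b) If $f=O_{p,q}(A_1;A_2)$ and $g=O_{r,q}(B_1;B_2)$, then the pointwise product $fg$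 is a tempered distribution, $fg=O_{l,q}\big(A_1+B_1;\,A_2B_2/(A_2+B_2)\big)$, and the number attached to this relation satisfies \[M_{l,q}(fg)\le\frac{B_2}{A_2+B_2}M_{p,q}(f)+\frac{A_2}{A_2+B_2}M_{r,q}(g).\] (c) If $f=O_{q,p}(A_1;A_2)$ and $g=O_{q,r}(B_1;B_2)$, then the convolution $g*f$ is well defined as a tempered distribution and $g*f=O_{q,l}\big(A_1B_1/(A_1+B_1);\,A_2+B_2\big)$. (d) If $h=O_2(C_1;C_2)$ and $t>0$, then \[e^{it\Delta}h=O_2\Big(\frac{C_1C_2}{C_2+4t\sqrt{C_1C_2}+4t^2C_1};\,C_2\Big).\] (e) If $h=O_2(C_1;C_2)$ and $\tau>0$, then \[e^{-i\tau|\cdot|^2}h=O_2\Big(C_1;\,\frac{C_1C_2}{C_1+4\tau\sqrt{C_1C_2}+4\tau^2C_2}\Big).\] -/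

import Mathlib

open MeasureTheory
open scoped SchwartzMap FourierTransform ENNReal

noncomputable section

namespace GaussianDecay

/-- The Euclidean space `ℝⁿ`. -/
abbrev Rn (n : ℕ) : Type := EuclideanSpace ℝ (Fin n)

/-- The linear change of variables `ξ ↦ ξ / (2π)` on `ℝⁿ`. -/
def scaling (n : ℕ) : Rn n ≃L[ℝ] Rn n :=
  ContinuousLinearEquiv.smulLeft
    (Units.mk0 ((2 * Real.pi)⁻¹ : ℝ) (inv_ne_zero (mul_pos two_pos Real.pi_pos).ne'))

/-- The factor `(2π)^{-n/2}`. -/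
def normConst (n : ℕ) : ℂ := (((2 * Real.pi) ^ (-(n : ℝ) / 2) : ℝ) : ℂ)

/-- The Fourier transform `φ ↦ (2π)^{-n/2} ∫ e^{-i x·ξ} φ(x) dx` on Schwartz functions
(see `schwartzFT_apply`). -/
def schwartzFT (n : ℕ) : 𝓢(Rn n, ℂ) →L[ℂ] 𝓢(Rn n, ℂ) :=
  normConst n • (SchwartzMap.compCLMOfContinuousLinearEquiv ℂ (scaling n) ∘L
    FourierTransform.fourierCLM ℂ 𝓢(Rn n, ℂ))

/-- The inverse transform `φ ↦ (2π)^{-n/2} ∫ e^{i x·ξ} φ(ξ) dξ` on Schwartz functions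
(see `schwartzFTInv_apply`). -/
def schwartzFTInv (n : ℕ) : 𝓢(Rn n, ℂ) →L[ℂ] 𝓢(Rn n, ℂ) :=
  normConst n • (SchwartzMap.compCLMOfContinuousLinearEquiv ℂ (scaling n) ∘L
    FourierTransform.fourierInvCLM ℂ 𝓢(Rn n, ℂ))

theorem schwartzFT_apply (n : ℕ) (φ : 𝓢(Rn n, ℂ)) (ξ : Rn n) :
    schwartzFT n φ ξ =
      normConst n * ∫ x : Rn n, Complex.exp (-(Complex.I * (inner ℝ x ξ : ℝ))) * φ x := by
  have h : schwartzFT n φ ξ = normConst n * (𝓕 φ) ((2 * Real.pi)⁻¹ • ξ) := rfl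
  rw [h, SchwartzMap.fourier_coe, Real.fourier_eq']
  congr 1
  refine integral_congr_ae (Filter.Eventually.of_forall fun x => ?_)
  simp only [smul_eq_mul, inner_smul_right]
  congr 2
  have hpi : (Real.pi : ℂ) ≠ 0 := by exact_mod_cast Real.pi_ne_zero
  push_cast
  field_simp

theorem schwartzFTInv_apply (n : ℕ) (φ : 𝓢(Rn n, ℂ)) (x : Rn n) :
    schwartzFTInv n φ x =
      normConst n * ∫ ξ : Rn n, Complex.exp (Complex.I * (inner ℝ ξ x : ℝ)) * φ ξ := by
  have h : schwartzFTInv n φ x = normConst n * (𝓕⁻ φ) ((2 * Real.pi)⁻¹ • x) := rfl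
  rw [h, SchwartzMap.fourierInv_coe, Real.fourierInv_eq']
  congr 1
  refine integral_congr_ae (Filter.Eventually.of_forall fun x => ?_)
  simp only [smul_eq_mul, inner_smul_right]
  congr 2
  have hpi : (Real.pi : ℂ) ≠ 0 := by exact_mod_cast Real.pi_ne_zero
  push_cast
  field_simp

/-- The Fourier transform of a tempered distribution: `⟨f̂, φ⟩ = ⟨f, φ̂⟩`. -/
def ft {n : ℕ} (f : 𝓢'(Rn n, ℂ)) : 𝓢'(Rn n, ℂ) :=
  PointwiseConvergenceCLM.precomp ℂ (schwartzFT n) f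

/-- The inverse Fourier transform of a tempered distribution: `⟨f^∨, φ⟩ = ⟨f, φ^∨⟩`. -/
def ftInv {n : ℕ} (f : 𝓢'(Rn n, ℂ)) : 𝓢'(Rn n, ℂ) :=
  PointwiseConvergenceCLM.precomp ℂ (schwartzFTInv n) f

/-- The function `x ↦ e^{-i s |x|²}`. -/
def chirp (n : ℕ) (s : ℝ) (x : Rn n) : ℂ := Complex.exp (-(Complex.I * s * (‖x‖ ^ 2 : ℝ)))

theorem chirp_hasTemperateGrowth (n : ℕ) (s : ℝ) : (chirp n s).HasTemperateGrowth := by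
  have h1 : (fun u : ℝ => Complex.exp (-(Complex.I * s * u))).HasTemperateGrowth := by
    have e : (fun u : ℝ => Complex.exp (-(Complex.I * s * u))) =
        fun u : ℝ => Complex.exp ((-(Complex.I * s)) * u) := by
      funext u; ring_nf
    have hd : ∀ k : ℕ, iteratedDeriv k (fun u : ℝ => Complex.exp ((-(Complex.I * s)) * u)) =
        fun u : ℝ => (-(Complex.I * s)) ^ k * Complex.exp ((-(Complex.I * s)) * u) := by
      intro k
      induction k with
      | zero => simp
      | succ k ih =>
        rw [iteratedDeriv_succ, ih]
        funext u
        have h2 : HasDerivAt (fun u : ℝ => (-(Complex.I * s)) * (u : ℂ)) (-(Complex.I * s)) u := by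
          simpa using (Complex.ofRealCLM.hasDerivAt (x := u)).const_mul (-(Complex.I * s))
        have h3 := (h2.cexp.const_mul ((-(Complex.I * s)) ^ k)).deriv
        rw [h3]; ring
    rw [e]
    refine ⟨?_, fun k => ⟨0, |s| ^ k, fun u => ?_⟩⟩
    · exact (contDiff_const.mul Complex.ofRealCLM.contDiff).cexp
    · rw [norm_iteratedFDeriv_eq_norm_iteratedDeriv, hd k]
      have h4 : ‖Complex.exp ((-(Complex.I * s)) * (u : ℂ))‖ = 1 := by
        rw [Complex.norm_exp]; simp
      rw [norm_mul, h4]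
      simp
  exact h1.comp (Function.hasTemperateGrowth_norm_sq (H := Rn n))

/-- Multiplication of a tempered distribution by the smooth function `e^{-i s |·|²}`. -/
def chirpMul {n : ℕ} (s : ℝ) (f : 𝓢'(Rn n, ℂ)) : 𝓢'(Rn n, ℂ) :=
  TemperedDistribution.smulLeftCLM ℂ (chirp n s) f

/-- The free Schrödinger group `e^{itΔ} f = (e^{-i t |ξ|²} f̂)^∨` on tempered distributions. -/
def schrodinger {n : ℕ} (t : ℝ) (f : 𝓢'(Rn n, ℂ)) : 𝓢'(Rn n, ℂ) :=
  ftInv (chirpMul t (ft f))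

/-- The tempered distribution `f` is (given by integration against) the function `F`. -/
def IsGivenBy {n : ℕ} (f : 𝓢'(Rn n, ℂ)) (F : Rn n → ℂ) : Prop :=
  LocallyIntegrable F volume ∧
    ∀ φ : 𝓢(Rn n, ℂ), Integrable (fun x => φ x * F x) volume ∧ f φ = ∫ x, φ x * F x

/-- `e^{A|·|²} f ∈ L^p(ℝⁿ)` for a tempered distribution `f`: it is a function with this
property. -/
def WeightedLp {n : ℕ} (p : ℝ≥0∞) (A : ℝ) (f : 𝓢'(Rn n, ℂ)) : Prop :=
  ∃ F : Rn n → ℂ, IsGivenBy f F ∧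
    MemLp (fun x => (Real.exp (A * ‖x‖ ^ 2) : ℂ) * F x) p volume

/-- `f = O_{p,q}(A₁; A₂)`. -/
def IsO {n : ℕ} (p q : ℝ≥0∞) (A₁ A₂ : ℝ) (f : 𝓢'(Rn n, ℂ)) : Prop :=
  WeightedLp p A₁ f ∧ WeightedLp q A₂ (ft f)

/-- The number `M_{p,q}(f) = A₁ A₂` attached to a relation `f = O_{p,q}(A₁; A₂)`. It depends on the
constants of the relation, not on `f` alone. -/
def M (A₁ A₂ : ℝ) : ℝ := A₁ * A₂

/-- `k` is the pointwise product of `f` and `g`, which are functions. -/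
def IsProduct {n : ℕ} (f g k : 𝓢'(Rn n, ℂ)) : Prop :=
  ∃ F G : Rn n → ℂ, IsGivenBy f F ∧ IsGivenBy g G ∧ IsGivenBy k (fun x => F x * G x)

/-- `k` is the convolution `f ∗ g (x) = ∫ f(y) g(x - y) dy` of `f` and `g`, which are functions;
the integral converges absolutely for almost every `x`. -/
def IsConvolution {n : ℕ} (f g k : 𝓢'(Rn n, ℂ)) : Prop :=
  ∃ F G : Rn n → ℂ, IsGivenBy f F ∧ IsGivenBy g G ∧
    (∀ᵐ x : Rn n, Integrable (fun y => F y * G (x - y)) volume) ∧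
    IsGivenBy k (fun x => ∫ y, F y * G (x - y))

end GaussianDecay

end

/-! Products and convolutions are Hölder's inequality, the convolution after completing the square:
`A|y|² + B|x - y|²` is `AB/(A + B) |x|²` plus a Gaussian weight centred at a multiple of `x`.

Multiplication by `e^{-iτ|x|²}` is the heart of the matter; the Schrödinger group is its conjugate
under the Fourier transform. Put `g = ĥ`. Multiplying the Fourier transform of `e^{-iτ|x|²} h` by
`e^{-ν·ξ}` amounts to shifting `x` to `x + iν`, under which the chirp acquires the modulus
`e^{2τ ν·x}`. Since a linear factor `e^{μ·x}` can be traded against the speed of the chirp, Hölder's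
inequality for the weights `e^{-sν·ξ}`, `0 ≤ s ≤ 1`, gives
`‖e^{-θν·ξ} (e^{-iτ|x|²} h)^‖₂ ≤ ‖e^{-ν·ξ} g‖₂^θ ‖e^{2T ν·x} h‖₂^{1-θ}` whenever
`T (1 - θ) = τ θ`; to justify the contour shift one first replaces `iτ` by `ε + iτ`. Averaging the
squares over a Gaussian `ν` turns the linear weights into Gaussian ones, and the choice
`θ = √C₁ / (√C₁ + 2|τ|√C₂)` gives the stated constants.
-/

noncomputable section

namespace GaussianDecay

section Weighted

variable {V : Type*} [NormedAddCommGroup V] [InnerProductSpace ℝ V] [FiniteDimensional ℝ V]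
  [MeasurableSpace V] [BorelSpace V]

theorem integrable_exp_neg_mul_sq_norm {κ : ℝ} (hκ : 0 < κ) :
    Integrable fun x : V => Real.exp (-(κ * ‖x‖ ^ 2)) := by
  have h := (GaussianFourier.integrable_cexp_neg_mul_sq_norm_add (V := V) (b := κ)
    (by simpa using hκ) 0 0).norm
  refine h.congr (.of_forall fun x => ?_)
  simp [Complex.norm_exp, ← Complex.ofReal_pow]

theorem memLp_exp_neg_mul_sq_norm {κ : ℝ} (hκ : 0 < κ) (p : ℝ≥0∞) :
    MemLp (fun x : V => Real.exp (-(κ * ‖x‖ ^ 2))) p := by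
  have hm : AEStronglyMeasurable (fun x : V => Real.exp (-(κ * ‖x‖ ^ 2))) volume := by fun_prop
  rcases eq_or_ne p 0 with rfl | hp0
  · exact memLp_zero_iff_aestronglyMeasurable.2 hm
  rcases eq_or_ne p ⊤ with rfl | hpt
  · refine memLp_top_of_bound hm 1 (.of_forall fun x => ?_)
    rw [Real.norm_of_nonneg (Real.exp_nonneg _), Real.exp_le_one_iff, neg_nonpos]
    positivity
  · rw [← integrable_norm_rpow_iff hm hp0 hpt]
    refine (integrable_exp_neg_mul_sq_norm (mul_pos hκ (ENNReal.toReal_pos hp0 hpt))).congr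
      (.of_forall fun x => ?_)
    beta_reduce
    rw [Real.norm_of_nonneg (Real.exp_nonneg _), ← Real.exp_mul]
    ring_nf

theorem ofReal_exp_neg_mul_exp (a : ℝ) : (Real.exp (-a) : ℂ) * Real.exp a = 1 := by
  rw [← Complex.ofReal_mul, ← Real.exp_add, neg_add_cancel, Real.exp_zero, Complex.ofReal_one]

/-- `e^{A|·|²} F ∈ L^p`, the analogue of `WeightedLp` for functions, on any Euclidean space. -/
def MemWeightedLp (p : ℝ≥0∞) (A : ℝ) (F : V → ℂ) : Prop :=
  MemLp (fun x => (Real.exp (A * ‖x‖ ^ 2) : ℂ) * F x) p volume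

namespace MemWeightedLp

variable {p q r l : ℝ≥0∞} {A B : ℝ} {F G : V → ℂ}

theorem congr_ae (hF : MemWeightedLp p A F) (h : F =ᵐ[volume] G) : MemWeightedLp p A G :=
  MemLp.ae_eq (h.mono fun x hx => by simp only [hx]) hF

protected theorem aestronglyMeasurable (hF : MemWeightedLp p A F) :
    AEStronglyMeasurable F volume := by
  have hexp : AEStronglyMeasurable (fun x : V => (Real.exp (-(A * ‖x‖ ^ 2)) : ℂ)) volume := by
    fun_prop
  refine (hexp.mul (MemLp.aestronglyMeasurable hF)).congr (.of_forall fun x => ?_)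
  simp only [Pi.mul_apply, ← mul_assoc, ofReal_exp_neg_mul_exp, one_mul]

protected theorem integrable (hF : MemWeightedLp q A F) (hq : 1 ≤ q) (hA : 0 < A) :
    Integrable F := by
  have := ENNReal.HolderConjugate.inv_one_sub_inv' hq
  refine (MemLp.integrable_mul (memLp_exp_neg_mul_sq_norm (V := V) hA (1 - q⁻¹)⁻¹).ofReal hF).congr
    (.of_forall fun x => ?_)
  simp only [Pi.mul_apply, ← mul_assoc]
  exact (congrArg (· * F x) (ofReal_exp_neg_mul_exp _)).trans (one_mul _)

theorem const_mul (hF : MemWeightedLp p A F) (c : ℂ) : MemWeightedLp p A fun x => c * F x := by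
  refine MemLp.ae_eq (.of_forall fun x => ?_) (MemLp.const_mul hF c)
  exact mul_left_comm _ _ _

theorem comp_neg (hF : MemWeightedLp p A F) : MemWeightedLp p A fun x => F (-x) := by
  refine MemLp.ae_eq (.of_forall fun x => ?_)
    (MemLp.comp_measurePreserving hF (Measure.measurePreserving_neg volume))
  simp only [Function.comp_apply, norm_neg]

theorem mono (hF : MemWeightedLp p A F) (hG : AEStronglyMeasurable G volume)
    (h : ∀ x, ‖G x‖ ≤ ‖F x‖) : MemWeightedLp p A G := by
  refine MemLp.mono hF (AEStronglyMeasurable.mul (by fun_prop) hG) (.of_forall fun x => ?_)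
  simp only [norm_mul]
  gcongr
  exact h x

theorem mul [ENNReal.HolderTriple p r l] (hF : MemWeightedLp p A F) (hG : MemWeightedLp r B G) :
    MemWeightedLp l (A + B) fun x => F x * G x := by
  refine MemLp.ae_eq (.of_forall fun x => ?_) (MemLp.mul hG hF (r := l))
  simp only [Pi.mul_apply, add_mul, Real.exp_add, Complex.ofReal_mul]
  ring

end MemWeightedLp

end Weighted

section Convolution

theorem lintegral_lintegral_mul_sub {G : Type*} [AddCommGroup G] [MeasurableSpace G]
    [MeasurableAdd₂ G] [MeasurableNeg G] {μ : Measure G} [SFinite μ] [μ.IsAddLeftInvariant]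
    {a b : G → ℝ≥0∞} (ha : AEMeasurable a μ) (hb : AEMeasurable b μ) :
    ∫⁻ x, ∫⁻ y, a y * b (x - y) ∂μ ∂μ = (∫⁻ y, a y ∂μ) * ∫⁻ y, b y ∂μ := by
  have hswap : AEMeasurable (Function.uncurry fun x y => a y * b (x - y)) (μ.prod μ) :=
    (ha.comp_quasiMeasurePreserving Measure.quasiMeasurePreserving_snd).mul
      (hb.comp_quasiMeasurePreserving (quasiMeasurePreserving_sub_of_right_invariant μ μ))
  have hinner : ∀ y, ∫⁻ x, a y * b (x - y) ∂μ = a y * ∫⁻ x, b x ∂μ := fun y => by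
    have hb' : AEMeasurable (fun x => b (x - y)) μ :=
      hb.comp_quasiMeasurePreserving (measurePreserving_sub_right μ y).quasiMeasurePreserving
    rw [lintegral_const_mul'' _ hb', lintegral_sub_right_eq_self]
  rw [lintegral_lintegral_swap hswap]
  simp_rw [hinner]
  exact lintegral_mul_const'' _ ha

theorem eLpNorm_eLpNorm_mul_sub_le {𝕜 G : Type*} [NormedDivisionRing 𝕜] [AddCommGroup G]
    [MeasurableSpace G] [MeasurableAdd₂ G] [MeasurableNeg G] {μ : Measure G} [SFinite μ]
    [μ.IsAddLeftInvariant] [μ.IsNegInvariant] {f g : G → 𝕜} (hf : AEStronglyMeasurable f μ)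
    (hg : AEStronglyMeasurable g μ) (q : ℝ≥0∞) :
    eLpNorm (fun x => eLpNorm (fun y => f y * g (x - y)) q μ) q μ ≤
      eLpNorm f q μ * eLpNorm g q μ := by
  rcases eq_or_ne q 0 with rfl | hq0
  · simp only [eLpNorm_exponent_zero, zero_mul, le_refl]
  rcases eq_or_ne q ⊤ with rfl | hqt
  · simp only [eLpNorm_exponent_top]
    refine eLpNormEssSup_le_of_ae_enorm_bound (.of_forall fun x => ?_)
    refine eLpNormEssSup_le_of_ae_enorm_bound ?_
    filter_upwards [enorm_ae_le_eLpNormEssSup f μ,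
      (Measure.measurePreserving_sub_left μ x).quasiMeasurePreserving.ae
        (enorm_ae_le_eLpNormEssSup g μ)] with y hfy hgy
    rw [enorm_mul]
    exact mul_le_mul' hfy hgy
  · have hq : 0 < q.toReal := ENNReal.toReal_pos hq0 hqt
    simp only [eLpNorm_eq_lintegral_rpow_enorm_toReal hq0 hqt, enorm_eq_self, ← ENNReal.rpow_mul,
      one_div, inv_mul_cancel₀ hq.ne', ENNReal.rpow_one, enorm_mul,
      ENNReal.mul_rpow_of_nonneg _ _ hq.le]
    rw [lintegral_lintegral_mul_sub (hf.enorm.pow_const _) (hg.enorm.pow_const _),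
      ENNReal.mul_rpow_of_nonneg _ _ (inv_nonneg.2 hq.le)]

variable {V : Type*} [NormedAddCommGroup V] [InnerProductSpace ℝ V]

theorem mul_norm_sq_add_mul_norm_sub_sq {A B : ℝ} (hAB : A + B ≠ 0) (x y : V) :
    A * ‖y‖ ^ 2 + B * ‖x - y‖ ^ 2 =
      A * B / (A + B) * ‖x‖ ^ 2 + (A + B) * ‖y - (B / (A + B)) • x‖ ^ 2 := by
  rw [norm_sub_sq_real, norm_sub_sq_real, real_inner_smul_right, norm_smul, mul_pow,
    Real.norm_eq_abs, sq_abs, real_inner_comm y x]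
  field_simp
  ring

theorem exp_mul_norm_sq_mul_eq {A B : ℝ} (hAB : A + B ≠ 0) (u v : V → ℂ) (x y : V) :
    (Real.exp (A * B / (A + B) * ‖x‖ ^ 2) : ℂ) * (u y * v (x - y)) =
      Real.exp (-((A + B) * ‖y - (B / (A + B)) • x‖ ^ 2)) *
        (((Real.exp (A * ‖y‖ ^ 2) : ℂ) * u y) *
          ((Real.exp (B * ‖x - y‖ ^ 2) : ℂ) * v (x - y))) := by
  have hexp : A * B / (A + B) * ‖x‖ ^ 2 =
      -((A + B) * ‖y - (B / (A + B)) • x‖ ^ 2) + (A * ‖y‖ ^ 2 + B * ‖x - y‖ ^ 2) := by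
    rw [mul_norm_sq_add_mul_norm_sub_sq hAB]
    ring
  rw [hexp, Real.exp_add, Real.exp_add]
  push_cast
  ring

variable [FiniteDimensional ℝ V] [MeasurableSpace V] [BorelSpace V]

theorem enorm_exp_mul_convolution_le {q : ℝ≥0∞} (hq : 1 ≤ q) {A B : ℝ} (hAB : A + B ≠ 0)
    {u v : V → ℂ} (hu : AEStronglyMeasurable u volume) (hv : AEStronglyMeasurable v volume)
    (x : V) :
    ‖(Real.exp (A * B / (A + B) * ‖x‖ ^ 2) : ℂ) * ∫ y, u y * v (x - y)‖ₑ ≤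
      eLpNorm (fun y : V => Real.exp (-((A + B) * ‖y‖ ^ 2))) (1 - q⁻¹)⁻¹ *
        eLpNorm (fun y => ((Real.exp (A * ‖y‖ ^ 2) : ℂ) * u y) *
          ((Real.exp (B * ‖x - y‖ ^ 2) : ℂ) * v (x - y))) q := by
  have := ENNReal.HolderConjugate.inv_one_sub_inv' hq
  have hv' : AEStronglyMeasurable (fun y => v (x - y)) volume :=
    hv.comp_quasiMeasurePreserving
      (Measure.measurePreserving_sub_left volume x).quasiMeasurePreserving
  have htrans : eLpNorm (fun y : V => Real.exp (-((A + B) * ‖y - (B / (A + B)) • x‖ ^ 2)))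
      (1 - q⁻¹)⁻¹ = eLpNorm (fun y : V => Real.exp (-((A + B) * ‖y‖ ^ 2))) (1 - q⁻¹)⁻¹ :=
    eLpNorm_comp_measurePreserving (g := fun y : V => Real.exp (-((A + B) * ‖y‖ ^ 2)))
      (by fun_prop) (measurePreserving_sub_right volume ((B / (A + B)) • x))
  rw [← integral_const_mul, ← htrans]
  refine (enorm_integral_le_lintegral_enorm _).trans ?_
  rw [← eLpNorm_one_eq_lintegral_enorm]
  refine le_of_eq_of_le ?_ (eLpNorm_smul_le_mul_eLpNorm (𝕜 := ℝ) (r := 1) ?_ ?_)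
  · exact congrArg (eLpNorm · 1 volume) (funext fun y => exp_mul_norm_sq_mul_eq hAB u v x y)
  · exact .mul (.mul (by fun_prop) hu) (.mul (by fun_prop) hv')
  · fun_prop

theorem MemWeightedLp.convolution {q : ℝ≥0∞} (hq : 1 ≤ q) {A B : ℝ} (hA : 0 < A) (hB : 0 < B)
    {u v : V → ℂ} (hu : MemWeightedLp q A u) (hv : MemWeightedLp q B v) :
    MemWeightedLp q (A * B / (A + B)) fun x => ∫ y, u y * v (x - y) := by
  have hAB : 0 < A + B := add_pos hA hB
  have hconv : AEStronglyMeasurable (fun x => ∫ y, u y * v (x - y)) volume :=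
    ((hu.integrable hq hA).integrable_convolution (ContinuousLinearMap.mul ℝ ℂ)
      (hv.integrable hq hB)).aestronglyMeasurable
  set K := eLpNorm (fun y : V => Real.exp (-((A + B) * ‖y‖ ^ 2))) (1 - q⁻¹)⁻¹
  have hK_top : K ≠ ⊤ := (memLp_exp_neg_mul_sq_norm hAB _).eLpNorm_ne_top
  have hbound : ∀ x, ‖(Real.exp (A * B / (A + B) * ‖x‖ ^ 2) : ℂ) * ∫ y, u y * v (x - y)‖ₑ ≤
      K.toNNReal * ‖eLpNorm (fun y => ((Real.exp (A * ‖y‖ ^ 2) : ℂ) * u y) *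
        ((Real.exp (B * ‖x - y‖ ^ 2) : ℂ) * v (x - y))) q‖ₑ := fun x => by
    rw [ENNReal.coe_toNNReal hK_top, enorm_eq_self]
    exact enorm_exp_mul_convolution_le hq hAB.ne' hu.aestronglyMeasurable
      hv.aestronglyMeasurable x
  have hmixed := eLpNorm_eLpNorm_mul_sub_le (MemLp.aestronglyMeasurable hu)
    (MemLp.aestronglyMeasurable hv) q
  refine ⟨.mul (by fun_prop) hconv,
    (eLpNorm_le_mul_eLpNorm_of_ae_le_mul' (.of_forall hbound) q).trans_lt ?_⟩
  exact ENNReal.mul_lt_top ENNReal.coe_lt_top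
    (hmixed.trans_lt (ENNReal.mul_lt_top (MemLp.eLpNorm_lt_top hu) (MemLp.eLpNorm_lt_top hv)))

end Convolution

section Fourier

section Euclidean

variable {V E : Type*} [NormedAddCommGroup V] [InnerProductSpace ℝ V] [FiniteDimensional ℝ V]
  [MeasurableSpace V] [BorelSpace V] [NormedAddCommGroup E]

theorem lintegral_comp_inv_smul {f : V → ℝ≥0∞} (hf : Measurable f) {R : ℝ} (hR : 0 < R) :
    ∫⁻ x, f (R⁻¹ • x) = ENNReal.ofReal (R ^ Module.finrank ℝ V) * ∫⁻ x, f x := by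
  rw [← lintegral_map hf (measurable_const_smul _),
    Measure.map_addHaar_smul volume (inv_ne_zero hR.ne'), lintegral_smul_measure, smul_eq_mul,
    inv_pow, inv_inv, abs_of_pos (by positivity)]

theorem eLpNorm_two_sq (F : V → E) : eLpNorm F 2 ^ 2 = ∫⁻ x, ‖F x‖ₑ ^ 2 := by
  rw [eLpNorm_eq_lintegral_rpow_enorm_toReal two_ne_zero ENNReal.ofNat_ne_top, ← ENNReal.rpow_two,
    ← ENNReal.rpow_mul]
  simp

theorem ae_eq_of_integral_schwartz_smul_eq [NormedSpace ℂ E] [CompleteSpace E] {F G : V → E}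
    (hF : LocallyIntegrable F) (hG : LocallyIntegrable G)
    (h : ∀ φ : 𝓢(V, ℂ), ∫ x, φ x • F x = ∫ x, φ x • G x) : F =ᵐ[volume] G := by
  let := NormedSpace.restrictScalars ℝ ℂ E
  refine ae_eq_of_integral_contDiff_smul_eq hF hG fun g hg hc => ?_
  have hsupp : HasCompactSupport (Complex.ofRealCLM ∘ g) := hc.comp_left rfl
  have hsmooth : ContDiff ℝ (⊤ : ℕ∞) (Complex.ofRealCLM ∘ g) := by fun_prop
  exact h (hsupp.toSchwartzMap hsmooth)

theorem continuous_fourier [NormedSpace ℂ E] {F : V → E} (hF : Integrable F) : Continuous (𝓕 F) :=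
  VectorFourier.fourierIntegral_continuous Real.continuous_fourierChar continuous_inner hF

theorem integral_fourier_comp_smul_smul [NormedSpace ℂ E] [CompleteSpace E] {F : V → ℂ}
    {G : V → E} (hF : Integrable F) (hG : Integrable G) (c : ℝ) :
    ∫ x, 𝓕 F (c • x) • G x = ∫ x, F x • 𝓕 G (c • x) := by
  have hcont : Continuous fun p : V × V => (c • innerₗ V) p.1 p.2 := by
    simp only [LinearMap.smul_apply, innerₗ_apply_apply]
    fun_prop
  have h := VectorFourier.integral_fourierIntegral_smul_eq_flip (μ := volume) (ν := volume)
    (L := c • innerₗ V) Real.continuous_fourierChar hcont hF hG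
  simpa only [VectorFourier.fourierIntegral, Real.fourier_eq, LinearMap.flip_apply,
    LinearMap.smul_apply, innerₗ_apply_apply, inner_smul_right, real_inner_comm,
    smul_eq_mul] using h

theorem eLpNorm_fourier_eq [InnerProductSpace ℂ E] [CompleteSpace E] {F : V → E}
    (hF : Integrable F) (hF2 : MemLp F 2) : eLpNorm (𝓕 F) 2 = eLpNorm F 2 := by
  have hF_Lp : hF2.toLp =ᵐ[volume] F := hF2.coeFn_toLp
  have hae : 𝓕 F =ᵐ[volume] (𝓕 hF2.toLp : Lp E 2 (volume : Measure V)) := by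
    refine ae_eq_of_integral_schwartz_smul_eq (continuous_fourier hF).locallyIntegrable
      ((Lp.memLp _).locallyIntegrable one_le_two) fun φ => ?_
    have hdist := DFunLike.congr_fun (Lp.fourier_toTemperedDistribution_eq hF2.toLp) φ
    rw [TemperedDistribution.fourier_apply, Lp.toTemperedDistribution_apply,
      Lp.toTemperedDistribution_apply] at hdist
    rw [← hdist, SchwartzMap.fourier_coe]
    have hadj := integral_fourier_comp_smul_smul φ.integrable hF 1
    simp only [one_smul] at hadj
    rw [← hadj]
    exact integral_congr_ae (hF_Lp.mono fun x hx => by simp only [hx])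
  rw [eLpNorm_congr_ae hae, ← Lp.enorm_def, ← eLpNorm_congr_ae hF_Lp, ← Lp.enorm_def,
    ← ofReal_norm, ← ofReal_norm]
  exact congrArg ENNReal.ofReal (Lp.norm_fourier_eq _)

end Euclidean

variable {n : ℕ} {F G : Rn n → ℂ}

/-- The Fourier transform `ξ ↦ (2π)^{-n/2} ∫ e^{-i x·ξ} F(x) dx` of a function. -/
def ftFun (F : Rn n → ℂ) (ξ : Rn n) : ℂ :=
  normConst n * ∫ x : Rn n, Complex.exp (-(Complex.I * (inner ℝ x ξ : ℝ))) * F x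

/-- The inverse Fourier transform `x ↦ (2π)^{-n/2} ∫ e^{i x·ξ} F(ξ) dξ` of a function. -/
def ftInvFun (F : Rn n → ℂ) (x : Rn n) : ℂ :=
  normConst n * ∫ ξ : Rn n, Complex.exp (Complex.I * (inner ℝ ξ x : ℝ)) * F ξ

theorem coe_schwartzFT (φ : 𝓢(Rn n, ℂ)) : ⇑(schwartzFT n φ) = ftFun φ :=
  funext (schwartzFT_apply n φ)

theorem coe_schwartzFTInv (φ : 𝓢(Rn n, ℂ)) : ⇑(schwartzFTInv n φ) = ftInvFun φ :=
  funext (schwartzFTInv_apply n φ)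

theorem ftInvFun_eq_ftFun_neg (F : Rn n → ℂ) (x : Rn n) : ftInvFun F x = ftFun F (-x) := by
  simp only [ftInvFun, ftFun, inner_neg_right, Complex.ofReal_neg, mul_neg, neg_neg]

theorem ftFun_comp_neg (F : Rn n → ℂ) (x : Rn n) : ftFun (fun y => F (-y)) x = ftInvFun F x := by
  rw [ftInvFun, ftFun, ← integral_neg_eq_self]
  simp only [inner_neg_left, Complex.ofReal_neg, mul_neg, neg_neg]

theorem ftFun_eq_fourier (F : Rn n → ℂ) (ξ : Rn n) :
    ftFun F ξ = normConst n * 𝓕 F ((2 * Real.pi)⁻¹ • ξ) := by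
  rw [ftFun, Real.fourier_eq']
  congr! 5 with x
  have hpi : (Real.pi : ℂ) ≠ 0 := Complex.ofReal_ne_zero.2 Real.pi_ne_zero
  rw [inner_smul_right]
  push_cast
  field_simp

theorem normConst_sq_mul (n : ℕ) : normConst n * normConst n * ((2 * Real.pi) ^ n : ℝ) = 1 := by
  have hpi : (0 : ℝ) < 2 * Real.pi := Real.two_pi_pos
  rw [normConst, ← Complex.ofReal_mul, ← Complex.ofReal_mul, ← Real.rpow_add hpi,
    ← Real.rpow_natCast, ← Real.rpow_add hpi]
  ring_nf
  simp

theorem normConst_ne_zero (n : ℕ) : normConst n ≠ 0 :=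
  left_ne_zero_of_mul (left_ne_zero_of_mul_eq_one (normConst_sq_mul n))

theorem ftInvFun_eq_fourierInv (F : Rn n → ℂ) (x : Rn n) :
    ftInvFun F x = (normConst n)⁻¹ * 𝓕⁻ (fun η => F ((2 * Real.pi) • η)) x := by
  have hscale := Measure.integral_comp_smul (volume : Measure (Rn n))
    (fun ξ => Complex.exp (Complex.I * (inner ℝ ξ x : ℝ)) * F ξ) (2 * Real.pi)
  rw [abs_of_pos (by positivity), finrank_euclideanSpace_fin, Complex.real_smul,
    Complex.ofReal_inv, inv_mul_eq_div,
    eq_div_iff (right_ne_zero_of_mul_eq_one (normConst_sq_mul n))] at hscale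
  rw [ftInvFun, ← hscale, Real.fourierInv_eq',
    eq_inv_mul_iff_mul_eq₀ (normConst_ne_zero n), ← mul_assoc, mul_comm (∫ _, _),
    ← mul_assoc, normConst_sq_mul, one_mul]
  congr! 4 with ξ
  rw [real_inner_smul_left, mul_comm]

theorem ftInvFun_ftFun_schwartz (φ : 𝓢(Rn n, ℂ)) : ftInvFun (ftFun φ) = φ := by
  funext x
  have hinv : 𝓕⁻ (𝓕 ⇑φ) = φ := φ.continuous.fourierInv_fourier_eq φ.integrable
    (by rw [← SchwartzMap.fourier_coe]; exact (𝓕 φ).integrable)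
  have hft : (fun η => ftFun φ ((2 * Real.pi) • η)) = normConst n • 𝓕 ⇑φ := by
    funext η
    rw [ftFun_eq_fourier, inv_smul_smul₀ Real.two_pi_pos.ne', Pi.smul_apply, smul_eq_mul]
  rw [ftInvFun_eq_fourierInv, hft, Real.fourierInv_eq]
  simp only [Pi.smul_apply, smul_comm _ (normConst n), integral_smul]
  rw [← Real.fourierInv_eq, hinv, smul_eq_mul, inv_mul_cancel_left₀ (normConst_ne_zero n)]

theorem ftFun_ftInvFun_schwartz (φ : 𝓢(Rn n, ℂ)) : ftFun (ftInvFun φ) = φ := by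
  have hneg : ftInvFun φ = fun y => ftFun φ (-y) := funext (ftInvFun_eq_ftFun_neg φ)
  rw [hneg, funext (ftFun_comp_neg (ftFun φ)), ftInvFun_ftFun_schwartz]

theorem continuous_ftFun (hF : Integrable F) : Continuous (ftFun F) := by
  rw [funext (ftFun_eq_fourier F)]
  exact continuous_const.mul ((continuous_fourier hF).comp (continuous_const_smul _))

theorem continuous_ftInvFun (hF : Integrable F) : Continuous (ftInvFun F) := by
  rw [funext (ftInvFun_eq_ftFun_neg F)]
  exact (continuous_ftFun hF).comp continuous_neg

theorem norm_ftFun_le (F : Rn n → ℂ) (ξ : Rn n) : ‖ftFun F ξ‖ ≤ ‖normConst n‖ * ∫ x, ‖F x‖ := by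
  rw [ftFun_eq_fourier, norm_mul]
  gcongr
  exact VectorFourier.norm_fourierIntegral_le_integral_norm _ _ _ _ _

theorem norm_ftInvFun_le (F : Rn n → ℂ) (x : Rn n) :
    ‖ftInvFun F x‖ ≤ ‖normConst n‖ * ∫ ξ, ‖F ξ‖ := by
  rw [ftInvFun_eq_ftFun_neg]
  exact norm_ftFun_le F _

theorem integral_ftFun_mul (hF : Integrable F) (hG : Integrable G) :
    ∫ x, ftFun F x * G x = ∫ x, F x * ftFun G x := by
  simp only [ftFun_eq_fourier, mul_assoc, mul_left_comm _ (normConst n), integral_const_mul]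
  exact congrArg _ (integral_fourier_comp_smul_smul hF hG _)

theorem integral_ftInvFun_mul (hF : Integrable F) (hG : Integrable G) :
    ∫ x, ftInvFun F x * G x = ∫ x, F x * ftInvFun G x := by
  simp_rw [← ftFun_comp_neg F, ftInvFun_eq_ftFun_neg G]
  rw [integral_ftFun_mul hF.comp_neg hG, ← integral_neg_eq_self]
  simp only [neg_neg]

theorem lintegral_enorm_ftFun_sq (hF : Integrable F) (hF2 : MemLp F 2) :
    ∫⁻ ξ, ‖ftFun F ξ‖ₑ ^ 2 = ∫⁻ x, ‖F x‖ₑ ^ 2 := by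
  have hconst : ‖normConst n‖ₑ ^ 2 * ENNReal.ofReal ((2 * Real.pi) ^ n) = 1 := by
    rw [sq, ← enorm_one (G := ℂ), ← normConst_sq_mul n, enorm_mul, enorm_mul,
      ← ofReal_norm (((2 * Real.pi) ^ n : ℝ) : ℂ), Complex.norm_of_nonneg (by positivity)]
  have hmeas : Measurable fun η => ‖𝓕 F η‖ₑ ^ 2 :=
    ((continuous_fourier hF).measurable.enorm.pow_const 2)
  simp_rw [ftFun_eq_fourier, enorm_mul, mul_pow]
  rw [lintegral_const_mul' _ _ (by finiteness), lintegral_comp_inv_smul hmeas Real.two_pi_pos,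
    ← eLpNorm_two_sq, eLpNorm_fourier_eq hF hF2, eLpNorm_two_sq, finrank_euclideanSpace_fin,
    ← mul_assoc, hconst, one_mul]

theorem lintegral_enorm_ftInvFun_sq (hF : Integrable F) (hF2 : MemLp F 2) :
    ∫⁻ x, ‖ftInvFun F x‖ₑ ^ 2 = ∫⁻ ξ, ‖F ξ‖ₑ ^ 2 := by
  simp_rw [ftInvFun_eq_ftFun_neg]
  rw [lintegral_neg_eq_self (fun x => ‖ftFun F x‖ₑ ^ 2), lintegral_enorm_ftFun_sq hF hF2]

theorem ftFun_convolution (hF : Integrable F) (hG : Integrable G) (ξ : Rn n) :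
    normConst n * ftFun (fun x => ∫ y, F y * G (x - y)) ξ = ftFun F ξ * ftFun G ξ := by
  have hconv : 𝓕 (fun x => ∫ y, F y * G (x - y)) ((2 * Real.pi)⁻¹ • ξ) =
      𝓕 F ((2 * Real.pi)⁻¹ • ξ) * 𝓕 G ((2 * Real.pi)⁻¹ • ξ) :=
    Real.fourier_mul_convolution_eq hF hG _
  rw [ftFun_eq_fourier, ftFun_eq_fourier, ftFun_eq_fourier, hconv]
  ring

theorem ftInvFun_convolution (hF : Integrable F) (hG : Integrable G) (x : Rn n) :
    normConst n * ftInvFun (fun x => ∫ y, F y * G (x - y)) x = ftInvFun F x * ftInvFun G x := by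
  simp only [ftInvFun_eq_ftFun_neg]
  exact ftFun_convolution hF hG _

end Fourier

section Distributions

variable {n : ℕ} {f : 𝓢'(Rn n, ℂ)} {F G U : Rn n → ℂ}

theorem ftInv_ft (f : 𝓢'(Rn n, ℂ)) : ftInv (ft f) = f := by
  ext φ
  have hφ : schwartzFT n (schwartzFTInv n φ) = φ := DFunLike.coe_injective <| by
    rw [coe_schwartzFT, coe_schwartzFTInv, ftFun_ftInvFun_schwartz]
  exact congrArg f hφ

theorem ft_ftInv (f : 𝓢'(Rn n, ℂ)) : ft (ftInv f) = f := by
  ext φ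
  have hφ : schwartzFTInv n (schwartzFT n φ) = φ := DFunLike.coe_injective <| by
    rw [coe_schwartzFTInv, coe_schwartzFT, ftInvFun_ftFun_schwartz]
  exact congrArg f hφ

theorem schwartzFT_schwartzFT (φ : 𝓢(Rn n, ℂ)) (x : Rn n) :
    schwartzFT n (schwartzFT n φ) x = φ (-x) := by
  rw [coe_schwartzFT, coe_schwartzFT, ← neg_neg x, ← ftInvFun_eq_ftFun_neg,
    ftInvFun_ftFun_schwartz, neg_neg]

theorem ft_ft_ft (f : 𝓢'(Rn n, ℂ)) : ft (ft (ft f)) = ftInv f := by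
  ext φ
  have hφ : schwartzFT n (schwartzFT n (schwartzFT n φ)) = schwartzFTInv n φ := by
    ext x
    rw [schwartzFT_schwartzFT, coe_schwartzFT, coe_schwartzFTInv, ftInvFun_eq_ftFun_neg]
  exact congrArg f hφ

theorem exists_isGivenBy {p : ℝ≥0∞} (hp : 1 ≤ p) (hF : MemLp F p) : ∃ f, IsGivenBy f F := by
  have : Fact (1 ≤ p) := ⟨hp⟩
  have := ENNReal.HolderConjugate.inv_one_sub_inv' hp
  refine ⟨Lp.toTemperedDistribution hF.toLp, hF.locallyIntegrable hp, fun φ =>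
    ⟨MemLp.integrable_mul (φ.memLp (1 - p⁻¹)⁻¹) hF, ?_⟩⟩
  rw [Lp.toTemperedDistribution_apply]
  exact integral_congr_ae (hF.coeFn_toLp.mono fun x hx => by
    simp only [hx, smul_eq_mul])

namespace IsGivenBy

theorem ae_eq (hF : IsGivenBy f F) (hG : IsGivenBy f G) : F =ᵐ[volume] G :=
  ae_eq_of_integral_schwartz_smul_eq hF.1 hG.1 fun φ => (hF.2 φ).2.symm.trans (hG.2 φ).2

theorem congr_ae (hF : IsGivenBy f F) (h : F =ᵐ[volume] G) : IsGivenBy f G := by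
  refine ⟨hF.1.congr h, fun φ => ?_⟩
  have hφ : (fun x => φ x * F x) =ᵐ[volume] fun x => φ x * G x :=
    h.mono fun x hx => congrArg (φ x * ·) hx
  exact ⟨(hF.2 φ).1.congr hφ, (hF.2 φ).2.trans (integral_congr_ae hφ)⟩

theorem of_continuous_of_bounded (hF : Continuous F) {C : ℝ} (hC : ∀ x, ‖F x‖ ≤ C)
    (h : ∀ φ : 𝓢(Rn n, ℂ), f φ = ∫ x, φ x * F x) : IsGivenBy f F :=
  ⟨hF.locallyIntegrable, fun φ =>
    ⟨φ.integrable.mul_bdd hF.aestronglyMeasurable (.of_forall hC), h φ⟩⟩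

protected theorem ft (hf : IsGivenBy f F) (hF : Integrable F) : IsGivenBy (ft f) (ftFun F) := by
  refine of_continuous_of_bounded (continuous_ftFun hF) (norm_ftFun_le F) fun φ => ?_
  rw [← integral_ftFun_mul φ.integrable hF, ← coe_schwartzFT]
  exact (hf.2 _).2

protected theorem ftInv (hf : IsGivenBy f F) (hF : Integrable F) :
    IsGivenBy (ftInv f) (ftInvFun F) := by
  refine of_continuous_of_bounded (continuous_ftInvFun hF) (norm_ftInvFun_le F) fun φ => ?_
  rw [← integral_ftInvFun_mul φ.integrable hF, ← coe_schwartzFTInv]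
  exact (hf.2 _).2

theorem of_ft (hU : IsGivenBy (ft f) U) (hUi : Integrable U) : IsGivenBy f (ftInvFun U) :=
  ftInv_ft f ▸ hU.ftInv hUi

theorem ft_of_ftInvFun (hf : IsGivenBy f (ftInvFun U)) (hU : Integrable U) :
    IsGivenBy (ft f) U := by
  obtain ⟨k, hk⟩ := exists_isGivenBy le_rfl (memLp_one_iff_integrable.2 hU)
  have hfk : f = ftInv k := by
    ext φ
    rw [(hf.2 φ).2, ((hk.ftInv hU).2 φ).2]
  rwa [hfk, ft_ftInv]

theorem ft_ft (hF : IsGivenBy f F) : IsGivenBy (ft (ft f)) fun x => F (-x) := by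
  refine ⟨?_, fun φ => ?_⟩
  · have hmap := Measure.map_neg_eq_self (volume : Measure (Rn n))
    exact (locallyIntegrable_map_homeomorph (Homeomorph.neg (Rn n))).1 (hmap.symm ▸ hF.1)
  · obtain ⟨hint, heq⟩ := hF.2 (schwartzFT n (schwartzFT n φ))
    simp only [schwartzFT_schwartzFT] at hint heq
    refine ⟨by simpa only [neg_neg] using hint.comp_neg, heq.trans ?_⟩
    rw [← integral_neg_eq_self]
    simp only [neg_neg]

end IsGivenBy

end Distributions

section Products

variable {n : ℕ} {p q r l : ℝ≥0∞} {A₁ A₂ B₁ B₂ : ℝ} {f g k : 𝓢'(Rn n, ℂ)}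

protected theorem IsO.ft (hf : IsO p q A₁ A₂ f) : IsO q p A₂ A₁ (ft f) := by
  obtain ⟨⟨F, hF, hFw⟩, hft⟩ := hf
  exact ⟨hft, _, hF.ft_ft, MemWeightedLp.comp_neg hFw⟩

theorem memLp_top_ftInvFun {F : Rn n → ℂ} (hF : Integrable F) : MemLp (ftInvFun F) ⊤ :=
  memLp_top_of_bound (continuous_ftInvFun hF).aestronglyMeasurable _
    (.of_forall (norm_ftInvFun_le F))

theorem exists_isProduct (hq : 1 ≤ q) (hA₂ : 0 < A₂) (hB₂ : 0 < B₂)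
    (hf : WeightedLp q A₂ (ft f)) (hg : WeightedLp q B₂ (ft g)) : ∃ k, IsProduct f g k := by
  obtain ⟨U, hU, hUw⟩ := hf
  obtain ⟨V, hV, hVw⟩ := hg
  have hUi : Integrable U := MemWeightedLp.integrable hUw hq hA₂
  have hVi : Integrable V := MemWeightedLp.integrable hVw hq hB₂
  obtain ⟨k, hk⟩ := exists_isGivenBy le_top
    ((memLp_top_ftInvFun hVi).mul (memLp_top_ftInvFun hUi) (r := ⊤))
  exact ⟨k, _, _, hU.of_ft hUi, hV.of_ft hVi, hk⟩

theorem IsProduct.weightedLp [ENNReal.HolderTriple p r l] (hk : IsProduct f g k)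
    (hf : WeightedLp p A₁ f) (hg : WeightedLp r B₁ g) : WeightedLp l (A₁ + B₁) k := by
  obtain ⟨F, hF, hFw⟩ := hf
  obtain ⟨G, hG, hGw⟩ := hg
  obtain ⟨F', G', hF', hG', hk⟩ := hk
  exact ⟨_, hk, MemWeightedLp.mul (MemWeightedLp.congr_ae hFw (hF.ae_eq hF'))
    (MemWeightedLp.congr_ae hGw (hG.ae_eq hG'))⟩

theorem IsProduct.weightedLp_ft (hq : 1 ≤ q) (hA₂ : 0 < A₂) (hB₂ : 0 < B₂)
    (hk : IsProduct f g k) (hf : WeightedLp q A₂ (ft f)) (hg : WeightedLp q B₂ (ft g)) :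
    WeightedLp q (A₂ * B₂ / (A₂ + B₂)) (ft k) := by
  obtain ⟨U, hU, hUw⟩ := hf
  obtain ⟨V, hV, hVw⟩ := hg
  obtain ⟨F, G, hF, hG, hk⟩ := hk
  have hUi : Integrable U := MemWeightedLp.integrable hUw hq hA₂
  have hVi : Integrable V := MemWeightedLp.integrable hVw hq hB₂
  have hconv : Integrable fun ξ => ∫ η, U η * V (ξ - η) :=
    hUi.integrable_convolution (ContinuousLinearMap.mul ℝ ℂ) hVi
  have hprod : (fun x => F x * G x) =ᵐ[volume]
      ftInvFun fun ξ => normConst n * ∫ η, U η * V (ξ - η) := by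
    filter_upwards [hF.ae_eq (hU.of_ft hUi), hG.ae_eq (hV.of_ft hVi)] with x hFx hGx
    rw [hFx, hGx, ← ftInvFun_convolution hUi hVi]
    simp only [ftInvFun, mul_left_comm _ (normConst n), integral_const_mul]
  exact ⟨_, (hk.congr_ae hprod).ft_of_ftInvFun (hconv.const_mul _),
    (MemWeightedLp.convolution hq hA₂ hB₂ hUw hVw).const_mul _⟩

theorem exists_isConvolution (hq : 1 ≤ q) (hA₁ : 0 < A₁) (hB₁ : 0 < B₁)
    (hf : WeightedLp q A₁ f) (hg : WeightedLp q B₁ g) : ∃ k, IsConvolution f g k := by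
  obtain ⟨F, hF, hFw⟩ := hf
  obtain ⟨G, hG, hGw⟩ := hg
  have hFi : Integrable F := MemWeightedLp.integrable hFw hq hA₁
  have hGi : Integrable G := MemWeightedLp.integrable hGw hq hB₁
  obtain ⟨k, hk⟩ := exists_isGivenBy le_rfl (memLp_one_iff_integrable.2
    (hFi.integrable_convolution (ContinuousLinearMap.mul ℝ ℂ) hGi))
  exact ⟨k, F, G, hF, hG, hFi.ae_convolution_exists (ContinuousLinearMap.mul ℝ ℂ) hGi, hk⟩

theorem IsConvolution.isGivenBy {F G : Rn n → ℂ} (hk : IsConvolution f g k) (hF : IsGivenBy f F)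
    (hG : IsGivenBy g G) : IsGivenBy k fun x => ∫ y, F y * G (x - y) := by
  obtain ⟨F', G', hF', hG', -, hk⟩ := hk
  exact hk.congr_ae (.of_eq (convolution_congr (ContinuousLinearMap.mul ℝ ℂ) (hF'.ae_eq hF)
    (hG'.ae_eq hG)))

theorem IsConvolution.weightedLp (hq : 1 ≤ q) (hA₁ : 0 < A₁) (hB₁ : 0 < B₁)
    (hk : IsConvolution f g k) (hf : WeightedLp q A₁ f) (hg : WeightedLp q B₁ g) :
    WeightedLp q (A₁ * B₁ / (A₁ + B₁)) k := by
  obtain ⟨F, hF, hFw⟩ := hf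
  obtain ⟨G, hG, hGw⟩ := hg
  exact ⟨_, hk.isGivenBy hF hG, MemWeightedLp.convolution hq hA₁ hB₁ hFw hGw⟩

theorem IsConvolution.weightedLp_ft [ENNReal.HolderTriple p r l] (hq : 1 ≤ q) (hA₁ : 0 < A₁)
    (hB₁ : 0 < B₁) (hk : IsConvolution f g k) (hf : IsO q p A₁ A₂ f) (hg : IsO q r B₁ B₂ g) :
    WeightedLp l (A₂ + B₂) (ft k) := by
  obtain ⟨⟨F, hF, hFw⟩, ⟨U, hU, hUw⟩⟩ := hf
  obtain ⟨⟨G, hG, hGw⟩, ⟨V, hV, hVw⟩⟩ := hg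
  have hFi : Integrable F := MemWeightedLp.integrable hFw hq hA₁
  have hGi : Integrable G := MemWeightedLp.integrable hGw hq hB₁
  have hprod : MemWeightedLp l (A₂ + B₂) fun ξ => ftFun F ξ * ftFun G ξ :=
    (MemWeightedLp.congr_ae hUw (hU.ae_eq (hF.ft hFi))).mul
      (MemWeightedLp.congr_ae hVw (hV.ae_eq (hG.ft hGi)))
  refine ⟨_, (hk.isGivenBy hF hG).ft
    (hFi.integrable_convolution (ContinuousLinearMap.mul ℝ ℂ) hGi),
    (hprod.const_mul (normConst n)⁻¹).congr_ae (.of_forall fun ξ => ?_)⟩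
  rw [inv_mul_eq_iff_eq_mul₀ (normConst_ne_zero n), ftFun_convolution hFi hGi]

end Products

section Tilt

variable {V : Type*} [NormedAddCommGroup V] [InnerProductSpace ℝ V] {p : ℝ≥0∞} {A : ℝ}
  {F : V → ℂ} {μ : V}

/-- The function `x ↦ e^{μ·x} F(x)`. -/
def tilt (μ : V) (F : V → ℂ) (x : V) : ℂ := (Real.exp (inner ℝ μ x) : ℂ) * F x

theorem tilt_zero (F : V → ℂ) : tilt 0 F = F := by
  funext x
  simp only [tilt, inner_zero_left, Real.exp_zero, Complex.ofReal_one, one_mul]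

theorem enorm_ofReal_exp_mul_sq (a : ℝ) (z : ℂ) :
    ‖(Real.exp a : ℂ) * z‖ₑ ^ 2 = ENNReal.ofReal (Real.exp (2 * a)) * ‖z‖ₑ ^ 2 := by
  rw [enorm_mul, mul_pow, ← ofReal_norm, Complex.norm_of_nonneg (Real.exp_nonneg _),
    ← ENNReal.ofReal_pow (Real.exp_nonneg _), ← Real.exp_nat_mul, Nat.cast_ofNat]

variable [MeasurableSpace V] [BorelSpace V] [FiniteDimensional ℝ V]

theorem tilt_aestronglyMeasurable (hF : AEStronglyMeasurable F volume) (μ : V) :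
    AEStronglyMeasurable (tilt μ F) volume :=
  AEStronglyMeasurable.mul (by fun_prop) hF

theorem MemWeightedLp.memLp (hF : MemWeightedLp p A F) (hA : 0 ≤ A) : MemLp F p := by
  refine MemLp.mono hF hF.aestronglyMeasurable (.of_forall fun x => ?_)
  rw [norm_mul, Complex.norm_of_nonneg (Real.exp_nonneg _)]
  exact le_mul_of_one_le_left (norm_nonneg _) (Real.one_le_exp (by positivity))

theorem MemWeightedLp.tilt (hF : MemWeightedLp p A F) (hA : 0 < A) (μ : V) :
    MemWeightedLp p (A / 2) (tilt μ F) := by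
  refine MemLp.of_le_mul (c := Real.exp (‖μ‖ ^ 2 / (2 * A))) hF
    (AEStronglyMeasurable.mul (by fun_prop) (tilt_aestronglyMeasurable hF.aestronglyMeasurable μ))
    (.of_forall fun x => ?_)
  simp only [GaussianDecay.tilt, norm_mul, Complex.norm_of_nonneg (Real.exp_nonneg _), ← mul_assoc,
    ← Real.exp_add]
  refine mul_le_mul_of_nonneg_right (Real.exp_le_exp.2 ?_) (norm_nonneg _)
  have hsq : ‖μ‖ ^ 2 / (2 * A) + A / 2 * ‖x‖ ^ 2 - ‖μ‖ * ‖x‖ =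
      (‖μ‖ - A * ‖x‖) ^ 2 / (2 * A) := by
    field_simp
    ring
  have hsq_nonneg : 0 ≤ (‖μ‖ - A * ‖x‖) ^ 2 / (2 * A) := by positivity
  linarith [real_inner_le_norm μ x]

theorem MemWeightedLp.integrable_tilt (hF : MemWeightedLp p A F) (hp : 1 ≤ p) (hA : 0 < A)
    (μ : V) : Integrable (GaussianDecay.tilt μ F) :=
  (hF.tilt hA μ).integrable hp (half_pos hA)

/-- The squared norm `∫ |e^{μ·x} F(x)|² dx`, infinite if `e^{μ·x} F ∉ L²`. -/
def tiltedNormSq (μ : V) (F : V → ℂ) : ℝ≥0∞ := ∫⁻ x, ‖tilt μ F x‖ₑ ^ 2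

theorem tiltedNormSq_eq (μ : V) (F : V → ℂ) : tiltedNormSq μ F =
    ∫⁻ x, ENNReal.ofReal (Real.exp (2 * inner ℝ μ x)) * ‖F x‖ₑ ^ 2 :=
  lintegral_congr fun _ => enorm_ofReal_exp_mul_sq _ _

theorem tiltedNormSq_zero (F : V → ℂ) : tiltedNormSq 0 F = ∫⁻ x, ‖F x‖ₑ ^ 2 := by
  rw [tiltedNormSq, tilt_zero]

theorem tiltedNormSq_smul_le (hF : AEStronglyMeasurable F volume) {θ : ℝ} (h0 : 0 ≤ θ)
    (h1 : θ ≤ 1) (μ : V) :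
    tiltedNormSq (θ • μ) F ≤ tiltedNormSq μ F ^ θ * tiltedNormSq 0 F ^ (1 - θ) := by
  have h1' : 0 ≤ 1 - θ := sub_nonneg.2 h1
  rw [tiltedNormSq_zero]
  refine le_of_eq_of_le (lintegral_congr fun x => ?_) (ENNReal.lintegral_mul_norm_pow_le
    ((tilt_aestronglyMeasurable hF μ).enorm.pow_const 2) (hF.enorm.pow_const 2) h0 h1'
    (add_sub_cancel θ 1))
  rw [tilt, tilt, enorm_ofReal_exp_mul_sq, enorm_ofReal_exp_mul_sq,
    ENNReal.mul_rpow_of_nonneg _ _ h0, mul_assoc, ← ENNReal.rpow_add_of_nonneg _ _ h0 h1',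
    add_sub_cancel, ENNReal.rpow_one, ENNReal.ofReal_rpow_of_nonneg (Real.exp_nonneg _) h0,
    ← Real.exp_mul, real_inner_smul_left]
  ring_nf

theorem tiltedNormSq_le_of_tendsto {ι : Type*} {u : Filter ι} [u.IsCountablyGenerated] [u.NeBot]
    {G : ι → V → ℂ} {c : ι → ℝ≥0∞} {C : ℝ≥0∞} (hG : ∀ j, AEStronglyMeasurable (G j) volume)
    (hGF : ∀ x, Filter.Tendsto (G · x) u (nhds (F x))) (hc : Filter.Tendsto c u (nhds C))
    (hle : ∀ j, tiltedNormSq μ (G j) ≤ c j) : tiltedNormSq μ F ≤ C := by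
  have hlim : ∀ x, Filter.liminf (fun j => ‖tilt μ (G j) x‖ₑ ^ 2) u = ‖tilt μ F x‖ₑ ^ 2 :=
    fun x => Filter.Tendsto.liminf_eq <| ((ENNReal.continuous_pow 2).tendsto _).comp <|
      ((hGF x).const_mul _).enorm
  calc tiltedNormSq μ F
      = ∫⁻ x, Filter.liminf (fun j => ‖tilt μ (G j) x‖ₑ ^ 2) u := by
        simp only [hlim, tiltedNormSq]
    _ ≤ Filter.liminf (fun j => tiltedNormSq μ (G j)) u :=
        lintegral_liminf_le' fun j => (tilt_aestronglyMeasurable (hG j) μ).enorm.pow_const 2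
    _ ≤ Filter.liminf c u := Filter.liminf_le_liminf (.of_forall hle)
    _ = C := hc.liminf_eq

theorem lintegral_exp_inner_stdGaussian (x : V) :
    ∫⁻ ν, ENNReal.ofReal (Real.exp (inner ℝ x ν)) ∂ProbabilityTheory.stdGaussian V =
      ENNReal.ofReal (Real.exp (‖x‖ ^ 2 / 2)) := by
  have hlaw : (ProbabilityTheory.stdGaussian V).map (innerSL ℝ x) =
      ProbabilityTheory.gaussianReal 0 (‖x‖ ^ 2).toNNReal := by
    rw [ProbabilityTheory.IsGaussian.map_eq_gaussianReal,
      ProbabilityTheory.integral_strongDual_stdGaussian,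
      ProbabilityTheory.variance_dual_stdGaussian, innerSL_apply_norm]
  have hmgf := ProbabilityTheory.mgf_gaussianReal hlaw 1
  have hint := ProbabilityTheory.mgf_pos_iff.1 (hmgf ▸ Real.exp_pos _)
  simp only [ProbabilityTheory.mgf, one_mul, innerSL_apply_apply, zero_add, one_pow,
    mul_one, Real.coe_toNNReal _ (sq_nonneg ‖x‖)] at hmgf hint
  rw [← ofReal_integral_eq_lintegral_ofReal hint (.of_forall fun _ => Real.exp_nonneg _), hmgf]

theorem aemeasurable_enorm_tilt_sq (hF : AEStronglyMeasurable F volume) (s : ℝ) (γ : Measure V)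
    [SFinite γ] :
    AEMeasurable (Function.uncurry fun ν x : V => ‖tilt (s • ν) F x‖ₑ ^ 2) (γ.prod volume) := by
  have hexp : Continuous fun z : V × V => (Real.exp (inner ℝ (s • z.1) z.2) : ℂ) := by fun_prop
  exact (hexp.aestronglyMeasurable.mul hF.comp_snd).enorm.pow_const 2

theorem lintegral_tiltedNormSq_stdGaussian (hF : AEStronglyMeasurable F volume) (s : ℝ) :
    ∫⁻ ν, tiltedNormSq (s • ν) F ∂ProbabilityTheory.stdGaussian V =
      ∫⁻ x, ‖(Real.exp (s ^ 2 * ‖x‖ ^ 2) : ℂ) * F x‖ₑ ^ 2 := by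
  simp only [tiltedNormSq]
  rw [lintegral_lintegral_swap (aemeasurable_enorm_tilt_sq hF s _)]
  refine lintegral_congr fun x => ?_
  have hinner : ∀ ν, 2 * inner ℝ (s • ν) x = inner ℝ ((2 * s) • x) ν := fun ν => by
    rw [real_inner_smul_left, real_inner_smul_left, real_inner_comm x, mul_assoc]
  simp only [tilt, enorm_ofReal_exp_mul_sq, hinner]
  rw [lintegral_mul_const' _ _ (by finiteness), lintegral_exp_inner_stdGaussian, norm_smul,
    mul_pow, Real.norm_eq_abs, sq_abs]
  ring_nf

theorem memWeightedLp_two_iff (hF : AEStronglyMeasurable F volume) :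
    MemWeightedLp 2 A F ↔ ∫⁻ x, ‖(Real.exp (A * ‖x‖ ^ 2) : ℂ) * F x‖ₑ ^ 2 ≠ ⊤ := by
  rw [← eLpNorm_two_sq, Ne, ENNReal.pow_eq_top_iff, not_and_or, not_not, or_iff_left two_ne_zero]
  exact ⟨fun h => h.eLpNorm_ne_top, fun h => ⟨AEStronglyMeasurable.mul (by fun_prop) hF,
    Ne.lt_top h⟩⟩

theorem MemWeightedLp.of_tiltedNormSq_le {G H : V → ℂ} {a b c θ : ℝ} (h0 : 0 ≤ θ) (h1 : θ ≤ 1)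
    (hF : MemWeightedLp 2 (a ^ 2) F) (hG : MemWeightedLp 2 (b ^ 2) G)
    (hH : AEStronglyMeasurable H volume)
    (hle : ∀ ν, tiltedNormSq (c • ν) H ≤
      tiltedNormSq (a • ν) F ^ θ * tiltedNormSq (b • ν) G ^ (1 - θ)) :
    MemWeightedLp 2 (c ^ 2) H := by
  have hFm := hF.aestronglyMeasurable
  have hGm := hG.aestronglyMeasurable
  have h1' : 0 ≤ 1 - θ := sub_nonneg.2 h1
  rw [memWeightedLp_two_iff hFm, ← lintegral_tiltedNormSq_stdGaussian hFm] at hF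
  rw [memWeightedLp_two_iff hGm, ← lintegral_tiltedNormSq_stdGaussian hGm] at hG
  rw [memWeightedLp_two_iff hH, ← lintegral_tiltedNormSq_stdGaussian hH]
  refine ne_top_of_le_ne_top (ENNReal.mul_ne_top (ENNReal.rpow_ne_top_of_nonneg h0 hF)
    (ENNReal.rpow_ne_top_of_nonneg h1' hG)) ((lintegral_mono hle).trans ?_)
  exact ENNReal.lintegral_mul_norm_pow_le
    (aemeasurable_enorm_tilt_sq hFm a _).lintegral_prod_right'
    (aemeasurable_enorm_tilt_sq hGm b _).lintegral_prod_right' h0 h1' (add_sub_cancel θ 1)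

end Tilt

section ContourShift

variable {n : ℕ} {b : ℂ}

/-- The value `-b z·z + μ·z` at the complex point `z = x + iν`. -/
def shiftedQuadratic (b : ℂ) (μ ν x : Rn n) : ℂ :=
  -b * ((‖x‖ ^ 2 : ℝ) - (‖ν‖ ^ 2 : ℝ) + 2 * Complex.I * (inner ℝ x ν : ℝ)) +
    (inner ℝ μ x : ℝ) + Complex.I * (inner ℝ μ ν : ℝ)

theorem continuous_shiftedQuadratic (b : ℂ) (μ ν : Rn n) :
    Continuous (shiftedQuadratic b μ ν) := by
  unfold shiftedQuadratic
  fun_prop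

theorem re_shiftedQuadratic (b : ℂ) (μ ν x : Rn n) : (shiftedQuadratic b μ ν x).re =
    b.re * ‖ν‖ ^ 2 - b.re * ‖x‖ ^ 2 + inner ℝ ((2 * b.im) • ν + μ) x := by
  simp only [shiftedQuadratic, Complex.add_re, Complex.mul_re, Complex.neg_re, Complex.sub_re,
    Complex.ofReal_re, Complex.ofReal_im, Complex.add_im, Complex.mul_im, Complex.neg_im,
    Complex.sub_im, Complex.I_re, Complex.I_im, Complex.re_ofNat, Complex.im_ofNat,
    inner_add_left, real_inner_smul_left, real_inner_comm ν x]
  ring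

theorem shiftedQuadratic_add_eq_sum (b : ℂ) (μ ν ζ x : Rn n) :
    shiftedQuadratic b μ ν x + Complex.I * (inner ℝ x ζ : ℝ) - (inner ℝ ν ζ : ℝ) =
      ∑ i, (-b * (x i + Complex.I * ν i) ^ 2 +
        (μ i + Complex.I * ζ i) * (x i + Complex.I * ν i)) := by
  simp only [shiftedQuadratic, EuclideanSpace.real_norm_sq_eq, PiLp.inner_apply,
    RCLike.inner_apply, conj_trivial, Complex.ofReal_sum, Complex.ofReal_mul, Complex.ofReal_pow,
    Finset.mul_sum, ← Finset.sum_sub_distrib, ← Finset.sum_add_distrib]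
  refine Finset.sum_congr rfl fun i _ => ?_
  linear_combination (b * ν i ^ 2 - ν i * ζ i : ℂ) * Complex.I_sq

theorem integral_cexp_sum_shift (hb : 0 < b.re) (c : Fin n → ℂ) (ν : Rn n) :
    ∫ x : Rn n, Complex.exp (∑ i, (-b * (x i + Complex.I * ν i) ^ 2 +
        c i * (x i + Complex.I * ν i))) =
      (Real.pi / b) ^ (n / 2 : ℂ) * Complex.exp ((∑ i, c i ^ 2) / (4 * b)) := by
  have hb0 : b ≠ 0 := by
    rintro rfl
    simp at hb
  have hexpand : ∀ x : Rn n, ∑ i, (-b * (x i + Complex.I * ν i) ^ 2 +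
      c i * (x i + Complex.I * ν i)) =
      (-b * ∑ i, (x i : ℂ) ^ 2 + ∑ i, (c i - 2 * Complex.I * b * ν i) * x i) +
        ∑ i, (b * ν i ^ 2 + Complex.I * c i * ν i) := fun x => by
    simp only [Finset.mul_sum, ← Finset.sum_add_distrib]
    refine Finset.sum_congr rfl fun i _ => ?_
    linear_combination (-b * ν i ^ 2 : ℂ) * Complex.I_sq
  have hsquare : (∑ i, (c i - 2 * Complex.I * b * ν i) ^ 2) / (4 * b) +
      ∑ i, (b * ν i ^ 2 + Complex.I * c i * ν i) = (∑ i, c i ^ 2) / (4 * b) := by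
    simp only [Finset.sum_div, ← Finset.sum_add_distrib]
    refine Finset.sum_congr rfl fun i _ => ?_
    field_simp
    linear_combination (4 * b ^ 2 * ν i ^ 2 : ℂ) * Complex.I_sq
  simp only [hexpand, Complex.exp_add _ (∑ i, (b * ν i ^ 2 + Complex.I * c i * ν i)),
    integral_mul_const]
  rw [← (PiLp.volume_preserving_toLp (Fin n)).integral_comp
    (MeasurableEquiv.toLp 2 _).measurableEmbedding,
    GaussianFourier.integral_cexp_neg_mul_sum_add hb, Fintype.card_fin, mul_assoc,
    ← Complex.exp_add, hsquare]

theorem integral_cexp_shiftedQuadratic (hb : 0 < b.re) (μ ν ζ : Rn n) :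
    ∫ x, Complex.exp (shiftedQuadratic b μ ν x + Complex.I * (inner ℝ x ζ : ℝ)) =
      Real.exp (inner ℝ ν ζ) *
        ∫ x, Complex.exp (shiftedQuadratic b μ 0 x + Complex.I * (inner ℝ x ζ : ℝ)) := by
  have hshift : ∀ ν : Rn n,
      ∫ x, Complex.exp (shiftedQuadratic b μ ν x + Complex.I * (inner ℝ x ζ : ℝ)) =
      Real.exp (inner ℝ ν ζ) * ((Real.pi / b) ^ (n / 2 : ℂ) *
        Complex.exp ((∑ i, (μ i + Complex.I * ζ i) ^ 2) / (4 * b))) := fun ν => by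
    rw [← integral_cexp_sum_shift hb _ ν, ← integral_const_mul]
    simp only [← shiftedQuadratic_add_eq_sum, Complex.ofReal_exp, ← Complex.exp_add,
      add_sub_cancel]
  rw [hshift ν, hshift 0, inner_zero_left, Real.exp_zero, Complex.ofReal_one, one_mul]

theorem integrable_cexp_shiftedQuadratic (hb : 0 < b.re) (μ ν : Rn n) :
    Integrable fun x => Complex.exp (shiftedQuadratic b μ ν x) := by
  have hreal := (GaussianFourier.integrable_cexp_neg_mul_sq_norm_add (b := b.re)
    (by simpa using hb) 1 ((2 * b.im) • ν + μ)).const_mul (Real.exp (b.re * ‖ν‖ ^ 2) : ℂ)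
  refine hreal.congr' (continuous_shiftedQuadratic b μ ν).cexp.aestronglyMeasurable
    (.of_forall fun x => ?_)
  rw [Complex.norm_exp, re_shiftedQuadratic, norm_mul, Complex.norm_exp,
    Complex.norm_of_nonneg (Real.exp_nonneg _), ← Real.exp_add]
  congr 1
  simp only [Complex.add_re, Complex.mul_re, Complex.neg_re, Complex.neg_im, ← Complex.ofReal_pow,
    Complex.ofReal_re, Complex.ofReal_im, Complex.one_re, Complex.one_im]
  ring

theorem memLp_two_cexp_shiftedQuadratic (hb : 0 < b.re) (μ ν : Rn n) :
    MemLp (fun x => Complex.exp (shiftedQuadratic b μ ν x)) 2 := by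
  have hb2 : 0 < (2 * b).re := by simpa using hb
  rw [memLp_two_iff_integrable_sq_norm
    (continuous_shiftedQuadratic b μ ν).cexp.aestronglyMeasurable]
  refine (integrable_cexp_shiftedQuadratic hb2 ((2 : ℝ) • μ) ν).norm.congr (.of_forall fun x => ?_)
  beta_reduce
  rw [← norm_pow, ← Complex.exp_nat_mul]
  congr 2
  simp only [shiftedQuadratic, real_inner_smul_left]
  push_cast
  ring

variable {g : Rn n → ℂ}

/-- The Fourier multiplier `g ↦ (e^Q g^∨)^` where `Q x = -b z·z + μ·z` is taken at `z = x + iν`. -/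
def gaussianMultiplier (b : ℂ) (μ ν : Rn n) (g : Rn n → ℂ) : Rn n → ℂ :=
  ftFun fun x => Complex.exp (shiftedQuadratic b μ ν x) * ftInvFun g x

theorem integrable_cexp_mul_ftInvFun (hg : Integrable g) (hb : 0 < b.re) (μ ν : Rn n) :
    Integrable fun x => Complex.exp (shiftedQuadratic b μ ν x) * ftInvFun g x :=
  (integrable_cexp_shiftedQuadratic hb μ ν).mul_bdd (continuous_ftInvFun hg).aestronglyMeasurable
    (.of_forall (norm_ftInvFun_le g))

theorem memLp_two_cexp_mul_ftInvFun (hg : Integrable g) (hb : 0 < b.re) (μ ν : Rn n) :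
    MemLp (fun x => Complex.exp (shiftedQuadratic b μ ν x) * ftInvFun g x) 2 :=
  (memLp_top_ftInvFun hg).mul (memLp_two_cexp_shiftedQuadratic hb μ ν)

theorem continuous_gaussianMultiplier (hg : Integrable g) (hb : 0 < b.re) (μ ν : Rn n) :
    Continuous (gaussianMultiplier b μ ν g) :=
  continuous_ftFun (integrable_cexp_mul_ftInvFun hg hb μ ν)

theorem gaussianMultiplier_eq_integral (hg : Integrable g) (hb : 0 < b.re) (μ ν ξ : Rn n) :
    gaussianMultiplier b μ ν g ξ = normConst n * ∫ η, g η * (normConst n *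
      ∫ x, Complex.exp (shiftedQuadratic b μ ν x + Complex.I * (inner ℝ x (η - ξ) : ℝ))) := by
  have hint : Integrable fun x : Rn n =>
      Complex.exp (-(Complex.I * (inner ℝ x ξ : ℝ))) * Complex.exp (shiftedQuadratic b μ ν x) := by
    refine (integrable_cexp_shiftedQuadratic hb μ ν).bdd_mul (c := 1) (by fun_prop)
      (.of_forall fun x => ?_)
    simp [Complex.norm_exp]
  rw [gaussianMultiplier, ftFun]
  simp only [← mul_assoc (Complex.exp _)]
  simp only [mul_comm _ (ftInvFun g _)]
  rw [integral_ftInvFun_mul hg hint]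
  simp only [ftInvFun, ← Complex.exp_add, inner_sub_right, Complex.ofReal_sub]
  ring_nf

theorem gaussianMultiplier_tilt (hg : Integrable g) {ν : Rn n} (hgν : Integrable (tilt (-ν) g))
    (hb : 0 < b.re) (μ : Rn n) :
    gaussianMultiplier b μ ν (tilt (-ν) g) = tilt (-ν) (gaussianMultiplier b μ 0 g) := by
  funext ξ
  have hexp : ∀ η, (Real.exp (inner ℝ (-ν) η) : ℂ) * Real.exp (inner ℝ ν (η - ξ)) =
      Real.exp (inner ℝ (-ν) ξ) := fun η => by
    rw [← Complex.ofReal_mul, ← Real.exp_add, inner_neg_left, inner_sub_right, inner_neg_left,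
      neg_add_eq_sub, sub_sub_cancel_left]
  rw [gaussianMultiplier_eq_integral hgν hb, tilt, gaussianMultiplier_eq_integral hg hb,
    mul_left_comm]
  congr 1
  rw [← integral_const_mul]
  refine integral_congr_ae (.of_forall fun η => ?_)
  beta_reduce
  rw [integral_cexp_shiftedQuadratic hb μ ν, tilt, ← hexp η]
  ring

theorem tiltedNormSq_gaussianMultiplier (hg : Integrable g) {ν : Rn n}
    (hgν : Integrable (tilt (-ν) g)) (hb : 0 < b.re) (μ : Rn n) :
    tiltedNormSq (-ν) (gaussianMultiplier b μ 0 g) =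
      ∫⁻ x, ENNReal.ofReal (Real.exp (2 * (shiftedQuadratic b μ ν x).re)) *
        ‖ftInvFun (tilt (-ν) g) x‖ₑ ^ 2 := by
  rw [tiltedNormSq, ← gaussianMultiplier_tilt hg hgν hb, gaussianMultiplier,
    lintegral_enorm_ftFun_sq (integrable_cexp_mul_ftInvFun hgν hb μ ν)
      (memLp_two_cexp_mul_ftInvFun hgν hb μ ν)]
  refine lintegral_congr fun x => ?_
  rw [← enorm_ofReal_exp_mul_sq, enorm_mul, enorm_mul, ← ofReal_norm (Complex.exp _),
    Complex.norm_exp, ← ofReal_norm (Real.exp _ : ℂ), Complex.norm_of_nonneg (Real.exp_nonneg _)]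

theorem tiltedNormSq_gaussianMultiplier_congr (hg : Integrable g) {ν : Rn n}
    (hgν : Integrable (tilt (-ν) g)) {b' : ℂ} (hb : 0 < b.re) (hre : b.re = b'.re) {μ μ' : Rn n}
    (him : (2 * b.im) • ν + μ = (2 * b'.im) • ν + μ') :
    tiltedNormSq (-ν) (gaussianMultiplier b μ 0 g) =
      tiltedNormSq (-ν) (gaussianMultiplier b' μ' 0 g) := by
  rw [tiltedNormSq_gaussianMultiplier hg hgν hb, tiltedNormSq_gaussianMultiplier hg hgν (hre ▸ hb)]
  simp only [re_shiftedQuadratic, hre, him]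

theorem tiltedNormSq_gaussianMultiplier_le (hg : Integrable g) {ν : Rn n}
    (hgν : Integrable (tilt (-ν) g)) (hb : 0 < b.re) (μ : Rn n) :
    tiltedNormSq (-ν) (gaussianMultiplier b μ 0 g) ≤
      ENNReal.ofReal (Real.exp (2 * b.re * ‖ν‖ ^ 2)) *
        tiltedNormSq ((2 * b.im) • ν + μ) (ftInvFun (tilt (-ν) g)) := by
  rw [tiltedNormSq_gaussianMultiplier hg hgν hb, tiltedNormSq_eq,
    ← lintegral_const_mul' _ _ ENNReal.ofReal_ne_top]
  refine lintegral_mono fun x => ?_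
  rw [← mul_assoc, ← ENNReal.ofReal_mul (Real.exp_nonneg _), ← Real.exp_add, re_shiftedQuadratic]
  gcongr
  nlinarith [mul_nonneg hb.le (sq_nonneg ‖x‖)]

end ContourShift

section Chirp

variable {n : ℕ} {A : ℝ} {b : ℂ} {g : Rn n → ℂ}

theorem tiltedNormSq_gaussianMultiplier_interpolate (hA : 0 < A) (hg : MemWeightedLp 2 A g)
    (hb : 0 < b.re) {θ T : ℝ} (h0 : 0 ≤ θ) (h1 : θ ≤ 1) (hT : T * (1 - θ) = b.im * θ) (ν : Rn n) :
    tiltedNormSq (-(θ • ν)) (gaussianMultiplier b 0 0 g) ≤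
      ENNReal.ofReal (Real.exp (2 * b.re * ‖ν‖ ^ 2)) ^ θ *
        (tiltedNormSq (-ν) g ^ θ * tiltedNormSq ((2 * T) • ν) (ftInvFun g) ^ (1 - θ)) := by
  have hgi : Integrable g := hg.integrable one_le_two hA
  have hgν (ν : Rn n) : Integrable (tilt (-ν) g) := hg.integrable_tilt one_le_two hA _
  -- On the line `im z = θ ν` the modulus of `e^{-b z·z}` is that of `e^{-b' z·z + 2T ν·z}`, whose
  -- linear term is cancelled at the endpoint `im z = ν`.
  let b' : ℂ := ⟨b.re, -T⟩
  have hendpoint_ν : tiltedNormSq (-ν) (gaussianMultiplier b' ((2 * T) • ν) 0 g) ≤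
      ENNReal.ofReal (Real.exp (2 * b.re * ‖ν‖ ^ 2)) * tiltedNormSq (-ν) g := by
    refine (tiltedNormSq_gaussianMultiplier_le (b := b') hgi (hgν ν) hb _).trans_eq ?_
    have hcancel : (2 * b'.im) • ν + (2 * T) • ν = 0 := by
      rw [← add_smul, mul_neg, neg_add_cancel, zero_smul]
    rw [hcancel, tiltedNormSq_zero, lintegral_enorm_ftInvFun_sq (hgν ν)
      ((hg.tilt hA _).memLp (half_pos hA).le), tiltedNormSq]
  have hendpoint_zero : tiltedNormSq 0 (gaussianMultiplier b' ((2 * T) • ν) 0 g) ≤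
      tiltedNormSq ((2 * T) • ν) (ftInvFun g) := by
    simpa [tilt_zero] using
      tiltedNormSq_gaussianMultiplier_le (b := b') hgi (hgν 0) hb ((2 * T) • ν)
  calc tiltedNormSq (-(θ • ν)) (gaussianMultiplier b 0 0 g)
      = tiltedNormSq (θ • -ν) (gaussianMultiplier b' ((2 * T) • ν) 0 g) := by
        rw [smul_neg]
        refine tiltedNormSq_gaussianMultiplier_congr (b' := b') hgi (hgν _) hb rfl ?_
        rw [smul_smul, smul_smul, ← add_smul, add_zero]
        congr 1
        linear_combination -2 * hT
    _ ≤ _ := tiltedNormSq_smul_le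
        (continuous_gaussianMultiplier (b := b') hgi hb _ _).aestronglyMeasurable h0 h1 _
    _ ≤ (ENNReal.ofReal (Real.exp (2 * b.re * ‖ν‖ ^ 2)) * tiltedNormSq (-ν) g) ^ θ *
        tiltedNormSq ((2 * T) • ν) (ftInvFun g) ^ (1 - θ) := by gcongr
    _ = _ := by rw [ENNReal.mul_rpow_of_nonneg _ _ h0, mul_assoc]

theorem tendsto_gaussianMultiplier (hh : Integrable (ftInvFun g)) {u : ℕ → ℂ}
    (hu : Filter.Tendsto u Filter.atTop (nhds b)) (hre : ∀ j, 0 ≤ (u j).re) (ξ : Rn n) :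
    Filter.Tendsto (fun j => gaussianMultiplier (u j) 0 0 g ξ) Filter.atTop
      (nhds (gaussianMultiplier b 0 0 g ξ)) := by
  refine Filter.Tendsto.const_mul _ (tendsto_integral_of_dominated_convergence
    (fun x => ‖ftInvFun g x‖) (fun j => ?_) hh.norm (fun j => .of_forall fun x => ?_)
    (.of_forall fun x => ?_))
  · exact AEStronglyMeasurable.mul (by fun_prop)
      ((continuous_shiftedQuadratic _ _ _).cexp.aestronglyMeasurable.mul hh.aestronglyMeasurable)
  · rw [← mul_assoc, norm_mul, ← Complex.exp_add, Complex.norm_exp]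
    refine mul_le_of_le_one_left (norm_nonneg _) (Real.exp_le_one_iff.2 ?_)
    rw [Complex.add_re, re_shiftedQuadratic]
    simpa using mul_nonneg (hre j) (sq_nonneg ‖x‖)
  · have hcont : Continuous fun z => Complex.exp (shiftedQuadratic z 0 0 x) := by
      unfold shiftedQuadratic
      fun_prop
    exact (((hcont.tendsto b).comp hu).mul_const _).const_mul _

theorem tiltedNormSq_gaussianMultiplier_I_le (hA : 0 < A) (hg : MemWeightedLp 2 A g)
    (hh : Integrable (ftInvFun g)) {τ θ T : ℝ} (h0 : 0 ≤ θ) (h1 : θ ≤ 1)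
    (hT : T * (1 - θ) = τ * θ) (ν : Rn n) :
    tiltedNormSq (-(θ • ν)) (gaussianMultiplier (τ * Complex.I) 0 0 g) ≤
      tiltedNormSq (-ν) g ^ θ * tiltedNormSq ((2 * T) • ν) (ftInvFun g) ^ (1 - θ) := by
  obtain ⟨ε, -, hε, hε_zero⟩ := exists_seq_strictAnti_tendsto (0 : ℝ)
  have hre (j : ℕ) : (ε j + τ * Complex.I : ℂ).re = ε j := by simp
  have hre_pos (j : ℕ) : 0 < (ε j + τ * Complex.I : ℂ).re := (hε j).trans_eq (hre j).symm
  have hb : Filter.Tendsto (fun j => (ε j + τ * Complex.I : ℂ)) Filter.atTop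
      (nhds (τ * Complex.I)) := by
    simpa using ((Complex.continuous_ofReal.tendsto 0).comp hε_zero).add_const (τ * Complex.I)
  refine tiltedNormSq_le_of_tendsto
    (fun j => (continuous_gaussianMultiplier (hg.integrable one_le_two hA)
      (hre_pos j) 0 0).aestronglyMeasurable)
    (tendsto_gaussianMultiplier hh hb fun j => (hre_pos j).le) ?_
    (fun j => tiltedNormSq_gaussianMultiplier_interpolate hA hg (hre_pos j) h0 h1
      (by simpa using hT) ν)
  have hexp : Filter.Tendsto
      (fun j => ENNReal.ofReal (Real.exp (2 * ε j * ‖ν‖ ^ 2)) ^ θ) Filter.atTop (nhds 1) := by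
    have hcont : Continuous fun e : ℝ => ENNReal.ofReal (Real.exp (2 * e * ‖ν‖ ^ 2)) ^ θ :=
      ENNReal.continuous_rpow_const.comp (ENNReal.continuous_ofReal.comp (by fun_prop))
    simpa [Function.comp_def] using (hcont.tendsto 0).comp hε_zero
  simpa only [hre, one_mul] using ENNReal.Tendsto.mul_const hexp (.inl one_ne_zero)

theorem gaussianMultiplier_mul_I (τ : ℝ) (g : Rn n → ℂ) :
    gaussianMultiplier (τ * Complex.I) 0 0 g = ftFun fun x => chirp n τ x * ftInvFun g x := by
  have hchirp (x : Rn n) : shiftedQuadratic (τ * Complex.I) 0 0 x =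
      -(Complex.I * τ * (‖x‖ ^ 2 : ℝ)) := by
    simp [shiftedQuadratic, mul_comm]
  simp only [gaussianMultiplier, hchirp, chirp]

theorem norm_chirp (τ : ℝ) (x : Rn n) : ‖chirp n τ x‖ = 1 := by
  simp [chirp, Complex.norm_exp, -Complex.ofReal_pow]

theorem continuous_chirp (τ : ℝ) : Continuous (chirp n τ) := by
  unfold chirp
  fun_prop

theorem integrable_chirp_mul {F : Rn n → ℂ} (hF : Integrable F) (τ : ℝ) :
    Integrable fun x => chirp n τ x * F x :=
  hF.bdd_mul (continuous_chirp τ).aestronglyMeasurable (.of_forall fun x => (norm_chirp τ x).le)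

theorem MemWeightedLp.chirp_mul {p : ℝ≥0∞} {F : Rn n → ℂ} (hF : MemWeightedLp p A F) (τ : ℝ) :
    MemWeightedLp p A fun x => chirp n τ x * F x :=
  hF.mono ((continuous_chirp τ).aestronglyMeasurable.mul hF.aestronglyMeasurable) fun x => by
    rw [norm_mul, norm_chirp, one_mul]

theorem exists_interpolation_exponent {a b : ℝ} (ha : 0 < a) (hb : 0 < b) (τ : ℝ) :
    ∃ θ T : ℝ, 0 ≤ θ ∧ θ ≤ 1 ∧ T * (1 - θ) = τ * θ ∧ (2 * T * b) ^ 2 = a ^ 2 ∧ (θ * b) ^ 2 =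
      a ^ 2 * b ^ 2 / (a ^ 2 + 4 * |τ| * √(a ^ 2 * b ^ 2) + 4 * τ ^ 2 * b ^ 2) := by
  have hsub : 1 - a / (a + 2 * |τ| * b) = 2 * |τ| * b / (a + 2 * |τ| * b) := by
    field_simp
    ring
  have hsq : a ^ 2 + 4 * |τ| * √(a ^ 2 * b ^ 2) + 4 * τ ^ 2 * b ^ 2 = (a + 2 * |τ| * b) ^ 2 := by
    rw [← mul_pow, Real.sqrt_sq (mul_pos ha hb).le, ← sq_abs τ]
    ring
  have hT (σ : ℝ) (hσ : σ * |τ| = τ) : σ * (a / (2 * b)) * (1 - a / (a + 2 * |τ| * b)) =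
      τ * (a / (a + 2 * |τ| * b)) := by
    rw [hsub]
    nth_rw 3 [← hσ]
    field_simp
  obtain ⟨σ, hσ, hσ_sq⟩ : ∃ σ : ℝ, σ * |τ| = τ ∧ σ ^ 2 = 1 := by
    rcases le_total 0 τ with h | h
    · exact ⟨1, by rw [abs_of_nonneg h, one_mul], one_pow 2⟩
    · exact ⟨-1, by rw [abs_of_nonpos h, neg_one_mul, neg_neg], neg_one_sq⟩
  refine ⟨a / (a + 2 * |τ| * b), σ * (a / (2 * b)), by positivity,
    sub_nonneg.1 (hsub ▸ by positivity), hT σ hσ, ?_, ?_⟩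
  · field_simp
    exact hσ_sq
  · rw [hsq]
    field_simp

theorem MemWeightedLp.ftFun_chirp_mul {C₁ C₂ : ℝ} (hC₁ : 0 < C₁) (hC₂ : 0 < C₂)
    (hg : MemWeightedLp 2 C₂ g) (hh : MemWeightedLp 2 C₁ (ftInvFun g)) (τ : ℝ) :
    MemWeightedLp 2 (C₁ * C₂ / (C₁ + 4 * |τ| * √(C₁ * C₂) + 4 * τ ^ 2 * C₂))
      (ftFun fun x => chirp n τ x * ftInvFun g x) := by
  obtain ⟨a, ha, rfl⟩ : ∃ a, 0 < a ∧ a ^ 2 = C₁ := ⟨√C₁, Real.sqrt_pos.2 hC₁, Real.sq_sqrt hC₁.le⟩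
  obtain ⟨b, hb, rfl⟩ : ∃ b, 0 < b ∧ b ^ 2 = C₂ := ⟨√C₂, Real.sqrt_pos.2 hC₂, Real.sq_sqrt hC₂.le⟩
  have hhi : Integrable (ftInvFun g) := hh.integrable one_le_two hC₁
  obtain ⟨θ, T, h0, h1, hT, hTa, hθ⟩ := exists_interpolation_exponent ha hb τ
  have hinterp (ν : Rn n) : tiltedNormSq (-(θ * b) • ν) (ftFun fun x => chirp n τ x * ftInvFun g x)
      ≤ tiltedNormSq (-b • ν) g ^ θ * tiltedNormSq ((2 * T * b) • ν) (ftInvFun g) ^ (1 - θ) := by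
    simpa only [gaussianMultiplier_mul_I, smul_smul, neg_smul] using
      tiltedNormSq_gaussianMultiplier_I_le hC₂ hg hhi h0 h1 hT (b • ν)
  rw [← hθ, ← neg_sq]
  rw [← neg_sq] at hg
  rw [← hTa] at hh
  exact .of_tiltedNormSq_le h0 h1 hg hh
    (continuous_ftFun (integrable_chirp_mul hhi τ)).aestronglyMeasurable hinterp

protected theorem IsGivenBy.chirpMul {f : 𝓢'(Rn n, ℂ)} {F : Rn n → ℂ} (hf : IsGivenBy f F)
    (τ : ℝ) : IsGivenBy (chirpMul τ f) fun x => chirp n τ x * F x := by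
  refine ⟨hf.1.mono ((continuous_chirp τ).aestronglyMeasurable.mul
    hf.1.aestronglyMeasurable) (.of_forall fun x => ?_), fun φ => ?_⟩
  · rw [norm_mul, norm_chirp, one_mul]
  · have hφ := hf.2 (SchwartzMap.smulLeftCLM ℂ (chirp n τ) φ)
    simp only [SchwartzMap.smulLeftCLM_apply_apply (chirp_hasTemperateGrowth n τ), smul_eq_mul,
      mul_assoc, mul_left_comm (chirp n τ _)] at hφ
    exact hφ

variable {C₁ C₂ : ℝ} {h : 𝓢'(Rn n, ℂ)}

protected theorem IsO.chirpMul (hC₁ : 0 < C₁) (hC₂ : 0 < C₂) (hh : IsO 2 2 C₁ C₂ h) (τ : ℝ) :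
    IsO 2 2 C₁ (C₁ * C₂ / (C₁ + 4 * |τ| * √(C₁ * C₂) + 4 * τ ^ 2 * C₂)) (chirpMul τ h) := by
  obtain ⟨⟨H, hH, hHw⟩, ⟨g, hg, hgw⟩⟩ := hh
  have hgh : IsGivenBy h (ftInvFun g) := hg.of_ft (MemWeightedLp.integrable hgw one_le_two hC₂)
  have hw : MemWeightedLp 2 C₁ (ftInvFun g) := MemWeightedLp.congr_ae hHw (hH.ae_eq hgh)
  have hk := hgh.chirpMul τ
  exact ⟨⟨_, hk, hw.chirp_mul τ⟩,
    ⟨_, hk.ft (integrable_chirp_mul (hw.integrable one_le_two hC₁) τ),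
      MemWeightedLp.ftFun_chirp_mul hC₁ hC₂ hgw hw τ⟩⟩

protected theorem IsO.schrodinger (hC₁ : 0 < C₁) (hC₂ : 0 < C₂) (hh : IsO 2 2 C₁ C₂ h) (t : ℝ) :
    IsO 2 2 (C₁ * C₂ / (C₂ + 4 * |t| * √(C₁ * C₂) + 4 * t ^ 2 * C₁)) C₂ (schrodinger t h) := by
  rw [schrodinger, ← ft_ft_ft, mul_comm C₁ C₂]
  exact (hh.ft.chirpMul hC₂ hC₁ t).ft.ft.ft

end Chirp

end GaussianDecay

end

open GaussianDecay in
theorem lemma2p3_general (n : ℕ) (p q r l : ℝ≥0∞) (hq : 1 ≤ q) (hl : 1 / p + 1 / r = 1 / l)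
    (A₁ A₂ B₁ B₂ C₁ C₂ : ℝ) (hA₁ : 0 < A₁) (hA₂ : 0 < A₂) (hB₁ : 0 < B₁) (hB₂ : 0 < B₂)
    (hC₁ : 0 < C₁) (hC₂ : 0 < C₂) :
    (∀ f : 𝓢'(Rn n, ℂ), IsO p q A₁ A₂ f → IsO q p A₂ A₁ (ft f)) ∧
    (∀ f g : 𝓢'(Rn n, ℂ), IsO p q A₁ A₂ f → IsO r q B₁ B₂ g →
      (∃ k, IsProduct f g k) ∧
      (∀ k, IsProduct f g k → IsO l q (A₁ + B₁) (A₂ * B₂ / (A₂ + B₂)) k) ∧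
      M (A₁ + B₁) (A₂ * B₂ / (A₂ + B₂)) ≤
        B₂ / (A₂ + B₂) * M A₁ A₂ + A₂ / (A₂ + B₂) * M B₁ B₂) ∧
    (∀ f g : 𝓢'(Rn n, ℂ), IsO q p A₁ A₂ f → IsO q r B₁ B₂ g →
      (∃ k, IsConvolution g f k) ∧
      ∀ k, IsConvolution g f k → IsO q l (A₁ * B₁ / (A₁ + B₁)) (A₂ + B₂) k) ∧
    (∀ h : 𝓢'(Rn n, ℂ), IsO 2 2 C₁ C₂ h → ∀ t : ℝ,
      IsO 2 2 (C₁ * C₂ / (C₂ + 4 * |t| * √(C₁ * C₂) + 4 * t ^ 2 * C₁)) C₂ (schrodinger t h)) ∧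
    (∀ h : 𝓢'(Rn n, ℂ), IsO 2 2 C₁ C₂ h → ∀ τ : ℝ,
      IsO 2 2 C₁ (C₁ * C₂ / (C₁ + 4 * |τ| * √(C₁ * C₂) + 4 * τ ^ 2 * C₂)) (chirpMul τ h)) := by
  have hprl : ENNReal.HolderTriple p r l := ⟨by simpa only [one_div] using hl⟩
  have hrpl : ENNReal.HolderTriple r p l := hprl.symm
  refine ⟨fun f hf => hf.ft, fun f g hf hg => ⟨?_, fun k hk => ⟨?_, ?_⟩, le_of_eq ?_⟩,
    fun f g hf hg => ⟨?_, fun k hk => ⟨?_, ?_⟩⟩,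
    fun h hh t => hh.schrodinger hC₁ hC₂ t, fun h hh τ => hh.chirpMul hC₁ hC₂ τ⟩
  · exact exists_isProduct hq hA₂ hB₂ hf.2 hg.2
  · exact hk.weightedLp hf.1 hg.1
  · exact hk.weightedLp_ft hq hA₂ hB₂ hf.2 hg.2
  · simp only [M]
    field_simp
  · exact exists_isConvolution hq hB₁ hA₁ hg.1 hf.1
  · rw [mul_comm A₁, add_comm A₁]
    exact hk.weightedLp hq hB₁ hA₁ hg.1 hf.1
  · rw [add_comm A₂]
    exact hk.weightedLp_ft hq hB₁ hA₁ hg hf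

open GaussianDecay in
theorem lemma2p3 (n : ℕ) (p q r l : ℝ≥0∞) (hp : 1 ≤ p) (hq : 1 ≤ q) (hr : 1 ≤ r)
    (hl : 1 / p + 1 / r = 1 / l)
    (A₁ A₂ B₁ B₂ C₁ C₂ : ℝ) (hA₁ : 0 < A₁) (hA₂ : 0 < A₂) (hB₁ : 0 < B₁) (hB₂ : 0 < B₂)
    (hC₁ : 0 < C₁) (hC₂ : 0 < C₂) :
    -- (a)
    (∀ f : 𝓢'(Rn n, ℂ), IsO p q A₁ A₂ f → IsO q p A₂ A₁ (ft f)) ∧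
    -- (b)
    (∀ f g : 𝓢'(Rn n, ℂ), IsO p q A₁ A₂ f → IsO r q B₁ B₂ g →
      (∃ k, IsProduct f g k) ∧
      (∀ k, IsProduct f g k → IsO l q (A₁ + B₁) (A₂ * B₂ / (A₂ + B₂)) k) ∧
      M (A₁ + B₁) (A₂ * B₂ / (A₂ + B₂)) ≤
        B₂ / (A₂ + B₂) * M A₁ A₂ + A₂ / (A₂ + B₂) * M B₁ B₂) ∧
    -- (c)
    (∀ f g : 𝓢'(Rn n, ℂ), IsO q p A₁ A₂ f → IsO q r B₁ B₂ g →
      (∃ k, IsConvolution g f k) ∧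
      ∀ k, IsConvolution g f k → IsO q l (A₁ * B₁ / (A₁ + B₁)) (A₂ + B₂) k) ∧
    -- (d)
    (∀ h : 𝓢'(Rn n, ℂ), IsO 2 2 C₁ C₂ h → ∀ t : ℝ, 0 < t →
      IsO 2 2 (C₁ * C₂ / (C₂ + 4 * t * √(C₁ * C₂) + 4 * t ^ 2 * C₁)) C₂ (schrodinger t h)) ∧
    -- (e)
    (∀ h : 𝓢'(Rn n, ℂ), IsO 2 2 C₁ C₂ h → ∀ τ : ℝ, 0 < τ →
      IsO 2 2 C₁ (C₁ * C₂ / (C₁ + 4 * τ * √(C₁ * C₂) + 4 * τ ^ 2 * C₂)) (chirpMul τ h)) := by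
  obtain ⟨ha, hb, hc, hd, he⟩ :=
    lemma2p3_general n p q r l hq hl A₁ A₂ B₁ B₂ C₁ C₂ hA₁ hA₂ hB₁ hB₂ hC₁ hC₂
  exact ⟨ha, hb, hc, fun h hh t ht => by simpa only [abs_of_pos ht] using hd h hh t,
    fun h hh τ hτ => by simpa only [abs_of_pos hτ] using he h hh τ⟩
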